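/- Let $G_{n,k}$ be the complex Grassmann manifold of $k$-dimensional subspaces of $\mathbb{C}^n$ with the canonical (coordinatewise) action of the compact torus $T^n$. Let $1\le k\le n-1$ and $1\le j\le n$. Let $i_0:G_{n-1,k}\to G_{n,k}$, $L\mapsto \iota_j(L)$, and $i_1:G_{n-1,k-1}\to G_{n,k}$, $L\mapsto \iota_j(L)\oplus\mathbb{C}e_j$, be the embeddings given by the $j$-th coordinate embedding $\iota_j:\mathbb{C}^{n-1}\to\mathbb{C}^n$ (insertion of $0$ at the $j$-th place). The torus $T^{n-1}$ acts on $G_{n-1,k}$ and $G_{n-1,k-1}$ canonically, and $T^n$ acts on them through the projection $T^n\to T^{n-1}$ that drops the $j$-th coordinate. There is a closed $T^n$-invariant smooth submanifold $S_{n,k}\subset G_{n,k}$ of real codimension one, and there are smooth surjective $T^n$-equivariant maps $\pi_0:S_{n,k}\to G_{n-1,k}$ and $\pi_1:S_{n,k}\to G_{n-1,k-1}$, such that the following holds. (1) There is a $T^n$-equivariant homeomorphism $$(S_{n,k}\times[0,1])\cup_{\pi_0}G_{n-1,k}\cup_{\pi_1}G_{n-1,k-1}\;\cong\; G_{n,k},\qquad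 (s,0)\sim\pi_0(s),\quad (s,1)\sim\pi_1(s),$$ which is $i_0$ on $G_{n-1,k}$ and $i_1$ on $G_{n-1,k-1}$, sends $(s,\tfrac12)$ to $s$, and restricts to a diffeomorphism of $S_{n,k}\times(0,1)$ onto $G_{n,k}\setminus(i_0(G_{n-1,k})\cup i_1(G_{n-1,k-1}))$. (2) The maps $\pi_0,\pi_1$ induce continuous maps $\hat\pi_0:S_{n,k}/T^n\to G_{n-1,k}/T^{n-1}$ and $\hat\pi_1:S_{n,k}/T^n\to G_{n-1,k-1}/T^{n-1}$, and the homeomorphism in (1) induces a homeomorphism $$(S_{n,k}/T^n\times[0,1])\cup_{\hat\pi_0}G_{n-1,k}/T^{n-1}\cup_{\hat\pi_1}G_{n-1,k-1}/T^{n-1}\;\cong\; G_{n,k}/T^n,$$ where $([s],0)\sim\hat\pi_0[s]$ and $([s],1)\sim\hat\pi_1[s]$. (3) If $k=2$ (so $n\ge 3$), then $G_{n,2}/T^n$ is homotopy equivalent to the space $C(S_{n,2}/T^n)\cup_{\hat\pi_0}G_{n-1,2}/T^{n-1}$ obtained by attaching the cone over $S_{n,2}/T^n$ to $G_{n-1,2}/T^{n-1}$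 along $\hat\pi_0$. Moreover $G_{2,2}/T^2$ is a point, so (3) describes $G_{n,2}/T^n$ inductively in terms of the spaces $S_{l,2}/T^l$, $3\le l\le n$. -/

import Mathlib

open scoped ContDiff

namespace TorusGrassmannian

/-! ## Complex Grassmann manifolds -/

/-- The Hermitian space `ℂⁿ`. -/
abbrev CSpace (n : ℕ) : Type := EuclideanSpace ℂ (Fin n)

/-- The complex Grassmann manifold `G_{n,k}`: all `k`-dimensional complex subspaces of `ℂⁿ`. -/
def Gr (n k : ℕ) : Type := {L : Submodule ℂ (CSpace n) // Module.finrank ℂ L = k}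

/-- The standard embedding of `G_{n,k}` into the real vector space of endomorphisms of `ℂⁿ`, which
sends a subspace to the orthogonal projection onto it. Its image is a compact smooth submanifold;
the topology and the smooth structure of `G_{n,k}` are those of this image. -/
noncomputable def Gr.proj {n k : ℕ} (L : Gr n k) : CSpace n →L[ℂ] CSpace n :=
  L.1.starProjection

noncomputable instance (n k : ℕ) : TopologicalSpace (Gr n k) :=
  TopologicalSpace.induced Gr.proj inferInstance

/-! ## Smoothness -/

/-- Smoothness of a map `f : X → Y` between spaces `X`, `Y` that are realised by injections `ι`, `κ`
as subsets of real normed spaces `V`, `W`: near each point of `X`, the map is the restriction of a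
`C^∞` map that is defined on an open subset of `V`. -/
def IsSmoothMap {X Y V W : Type*} [NormedAddCommGroup V] [NormedSpace ℝ V]
    [NormedAddCommGroup W] [NormedSpace ℝ W] (ι : X → V) (κ : Y → W) (f : X → Y) : Prop :=
  ∀ x : X, ∃ (U : Set V) (g : V → W), IsOpen U ∧ ι x ∈ U ∧ ContDiffOn ℝ ∞ g U ∧
    ∀ y : X, ι y ∈ U → κ (f y) = g (ι y)

/-- `S` is a smooth submanifold of `G_{n,k}` of real codimension one: near each of its points `L`,
it is the zero set in `G_{n,k}` of a real `C^∞` function `f` whose differential on the tangent space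
of `G_{n,k}` at `L` is not zero, that is, `f` has a nonzero derivative at `L` along some smooth
curve `γ` in `G_{n,k}`. -/
def IsSmoothHypersurface {n k : ℕ} (S : Set (Gr n k)) : Prop :=
  ∀ L ∈ S, ∃ (U : Set (CSpace n →L[ℂ] CSpace n)) (f : (CSpace n →L[ℂ] CSpace n) → ℝ),
    IsOpen U ∧ L.proj ∈ U ∧ ContDiffOn ℝ ∞ f U ∧
    (∀ M : Gr n k, M.proj ∈ U → (M ∈ S ↔ f M.proj = 0)) ∧
    ∃ γ : ℝ → Gr n k, γ 0 = L ∧ ContDiffAt ℝ ∞ (fun t => (γ t).proj) 0 ∧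
      deriv (fun t => f (γ t).proj) 0 ≠ 0

/-! ## The canonical torus action -/

/-- The compact torus `Tⁿ`. -/
abbrev Torus (n : ℕ) : Type := Fin n → Circle

/-- The coordinatewise action of an element of `Tⁿ` on `ℂⁿ`. -/
noncomputable def Torus.lin {n : ℕ} (t : Torus n) : CSpace n ≃ₗ[ℂ] CSpace n where
  toFun z := WithLp.toLp 2 fun i => (t i : ℂ) * z i
  invFun z := WithLp.toLp 2 fun i => ((t i)⁻¹ : Circle) * z i
  map_add' x y := by ext i; simp [mul_add]
  map_smul' c x := by ext i; simp [mul_left_comm]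
  left_inv x := by ext i; simp
  right_inv x := by ext i; simp

/-- The canonical action of `Tⁿ` on `G_{n,k}`. -/
noncomputable instance (n k : ℕ) : MulAction (Torus n) (Gr n k) where
  smul t L := ⟨L.1.map (t.lin : CSpace n →ₗ[ℂ] CSpace n),
    (LinearEquiv.finrank_map_eq t.lin L.1).trans L.2⟩
  one_smul L := by
    apply Subtype.ext
    change L.1.map ((1 : Torus n).lin : CSpace n →ₗ[ℂ] CSpace n) = L.1
    have h : ((1 : Torus n).lin : CSpace n →ₗ[ℂ] CSpace n) = LinearMap.id := by
      ext x i; simp [Torus.lin]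
    rw [h, Submodule.map_id]
  mul_smul s t L := by
    apply Subtype.ext
    change L.1.map ((s * t).lin : CSpace n →ₗ[ℂ] CSpace n)
      = (L.1.map (t.lin : CSpace n →ₗ[ℂ] CSpace n)).map (s.lin : CSpace n →ₗ[ℂ] CSpace n)
    rw [← Submodule.map_comp]
    congr 1
    ext x i; simp [Torus.lin, mul_assoc]

/-- The orbit space `X / T`, with the quotient topology. -/
abbrev OrbitSpace (T X : Type*) [Group T] [MulAction T X] : Type _ :=
  Quotient (MulAction.orbitRel T X)

/-- The orbit of a point, as an element of the orbit space. -/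
def orb (T : Type*) {X : Type*} [Group T] [MulAction T X] (x : X) : OrbitSpace T X :=
  Quotient.mk _ x

/-- The projection `Tⁿ⁺¹ → Tⁿ` which drops the `j`-th coordinate. -/
def Torus.drop {n : ℕ} (j : Fin (n + 1)) (t : Torus (n + 1)) : Torus n :=
  fun i => t (j.succAbove i)

/-! ## The two coordinate embeddings of smaller Grassmann manifolds -/

/-- The coordinate embedding `ℂⁿ → ℂⁿ⁺¹` which inserts `0` at the `j`-th place. -/
noncomputable def coordIncl {n : ℕ} (j : Fin (n + 1)) : CSpace n →ₗ[ℂ] CSpace (n + 1) where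
  toFun z := WithLp.toLp 2 (j.insertNth (0 : ℂ) fun i => z i)
  map_add' x y := by
    ext i
    refine j.succAboveCases ?_ (fun i => ?_) i <;> simp
  map_smul' c x := by
    ext i
    refine j.succAboveCases ?_ (fun i => ?_) i <;> simp

theorem coordIncl_apply_same {n : ℕ} (j : Fin (n + 1)) (z : CSpace n) : coordIncl j z j = 0 := by
  simp [coordIncl]

theorem coordIncl_apply_succAbove {n : ℕ} (j : Fin (n + 1)) (z : CSpace n) (i : Fin n) :
    coordIncl j z (j.succAbove i) = z i := by
  simp [coordIncl]

theorem coordIncl_injective {n : ℕ} (j : Fin (n + 1)) : Function.Injective (coordIncl j) := by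
  intro x y h
  ext i
  rw [← coordIncl_apply_succAbove j x i, h, coordIncl_apply_succAbove]

/-- The embedding `G_{n,k} → G_{n+1,k}` which is induced by the `j`-th coordinate embedding
`ℂⁿ → ℂⁿ⁺¹`. -/
noncomputable def inclZero {n k : ℕ} (j : Fin (n + 1)) (L : Gr n k) : Gr (n + 1) k :=
  ⟨L.1.map (coordIncl j),
    (LinearEquiv.finrank_eq (L.1.equivMapOfInjective _ (coordIncl_injective j))).symm.trans L.2⟩

theorem finrank_map_sup_span {n : ℕ} (j : Fin (n + 1)) (L : Submodule ℂ (CSpace n)) :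
    Module.finrank ℂ
      (L.map (coordIncl j) ⊔ Submodule.span ℂ {EuclideanSpace.single j (1 : ℂ)} :
        Submodule ℂ (CSpace (n + 1))) = Module.finrank ℂ L + 1 := by
  have hd : L.map (coordIncl j) ⊓ Submodule.span ℂ {EuclideanSpace.single j (1 : ℂ)} = ⊥ := by
    rw [Submodule.eq_bot_iff]
    rintro x ⟨⟨y, -, rfl⟩, hx⟩
    obtain ⟨c, hc⟩ := Submodule.mem_span_singleton.1 hx
    have h := congrArg (fun v : CSpace (n + 1) => v j) hc
    simp only [coordIncl_apply_same] at h
    have hc0 : c = 0 := by simpa using h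
    rw [← hc, hc0, zero_smul]
  have h := Submodule.finrank_sup_add_finrank_inf_eq (L.map (coordIncl j))
    (Submodule.span ℂ {EuclideanSpace.single j (1 : ℂ)})
  rw [hd, finrank_bot, add_zero, finrank_span_singleton (by simp),
    ← LinearEquiv.finrank_eq (L.equivMapOfInjective _ (coordIncl_injective j))] at h
  exact h

/-- The embedding `G_{n,k} → G_{n+1,k+1}` which adds the `j`-th coordinate line to the image of a
subspace under the `j`-th coordinate embedding `ℂⁿ → ℂⁿ⁺¹`. -/
noncomputable def inclOne {n k : ℕ} (j : Fin (n + 1)) (L : Gr n k) : Gr (n + 1) (k + 1) :=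
  ⟨L.1.map (coordIncl j) ⊔ Submodule.span ℂ {EuclideanSpace.single j (1 : ℂ)}, by
    rw [finrank_map_sup_span, L.2]⟩

/-! ## Gluing -/

/-- The identifications `(x, 0) ∼ p x` and `(x, 1) ∼ q x`. -/
inductive GlueRel {X A B : Type*} (p : X → A) (q : X → B) :
    (X × unitInterval) ⊕ (A ⊕ B) → (X × unitInterval) ⊕ (A ⊕ B) → Prop
  | zero (x : X) : GlueRel p q (Sum.inl (x, 0)) (Sum.inr (Sum.inl (p x)))
  | one (x : X) : GlueRel p q (Sum.inl (x, 1)) (Sum.inr (Sum.inr (q x)))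

/-- The space `(X × [0,1]) ∪_p A ∪_q B` : the quotient of the disjoint union of `X × [0,1]`, `A`
and `B` by the equivalence relation that is generated by `(x, 0) ∼ p x` and `(x, 1) ∼ q x`. -/
def Glue {X A B : Type*} (p : X → A) (q : X → B) : Type _ := Quot (GlueRel p q)

instance {X A B : Type*} [TopologicalSpace X] [TopologicalSpace A] [TopologicalSpace B]
    (p : X → A) (q : X → B) : TopologicalSpace (Glue p q) :=
  inferInstanceAs (TopologicalSpace (Quot (GlueRel p q)))

namespace Glue

variable {X A B : Type*} (p : X → A) (q : X → B)

/-- The class of a point of the cylinder. -/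
def cyl (x : X) (t : unitInterval) : Glue p q := Quot.mk _ (Sum.inl (x, t))

/-- The class of a point of the space that is glued on at the end `0`. -/
def left (a : A) : Glue p q := Quot.mk _ (Sum.inr (Sum.inl a))

/-- The class of a point of the space that is glued on at the end `1`. -/
def right (b : B) : Glue p q := Quot.mk _ (Sum.inr (Sum.inr b))

end Glue

/-- The space `C(X) ∪_f A` that is obtained by attaching the cone over `X` to `A` along
`f : X → A`: the end `X × {1}` of the cylinder is collapsed to the apex of the cone, and each point
`(x, 0)` of its base is identified with `f x`. -/
abbrev AttachCone {X A : Type*} (f : X → A) : Type _ := Glue f (fun _ : X => PUnit.unit.{1})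

/-- The inclusion of the open interval `(0,1)` into `[0,1]`. -/
def openToUnit (t : Set.Ioo (0 : ℝ) 1) : unitInterval := ⟨t, Set.Ioo_subset_Icc_self t.2⟩

/-- The real number `1/2` as a point of `[0,1]`. -/
noncomputable def middle : unitInterval := ⟨1 / 2, by norm_num, by norm_num⟩

end TorusGrassmannian

open TorusGrassmannian

/-! Fix the unit vector `e = e_j` and let `P` be the orthogonal projection onto `L`. The number `μ =
⟨e, P e⟩ = ‖P e‖²` (`height`) is the squared cosine of the angle between `L` and `e`. It equals 0
exactly on the image of `inclZero` and 1 exactly on the image of `inclOne`. In between, `L` splits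
orthogonally as `(L ∩ e^⊥) ⊕ ℂ (√μ e + √(1-μ) u)`, with `u` a unit vector orthogonal to `e` and to
`L ∩ e^⊥`. So a generic `L` is encoded by a frame (the projection `A` onto `L ∩ e^⊥`, called `core`,
and `u`, called `direction`) together with `μ`.

Take `S` to be the level `μ = 1/2`. The cylinder point `(s, t)` keeps the frame of `s` and replaces
the last line by the span of `√t e + √(1-t) u`; its height is `t`. At `t = 0` this is `A ⊕ ℂu`, a
subspace of `e^⊥`, which defines `projZero`; at `t = 1` it is `A ⊕ ℂe`, so `projOne` records `A`.
Conversely, height and frame recover `(s, t)` (`core_enlarge`, `direction_enlarge`,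
`rotate_rotate`). The resulting map from the glued space is a continuous bijection from a compact
space to a Hausdorff one, hence a homeomorphism. The formulas in `P` are smooth where `0 < μ < 1`,
which gives the diffeomorphism. They commute with every unitary having `e` as an eigenvector
(`rotate_conjBy`), in particular with the torus.

The decomposition descends to orbit spaces because dropping a coordinate maps the big torus onto the
small one, so both have the same orbits on the two ends (`exists_orbit_homeomorph`). For
two-dimensional subspaces the end at 1 is the orbit space of a projective space, which the moment
map identifies with a simplex. A contractible end of a cylinder may be replaced by a point up to
homotopy (`Glue.homotopyEquiv_attachCone`), and this turns the cylinder into a cone.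

Indices are shifted: the large Grassmannian consists of the `(k+1)`-dimensional subspaces of `ℂⁿ⁺¹`.
-/

namespace TorusGrassmannian

open InnerProductSpace

/-! ### Splitting a projection relative to a unit vector -/

section Projections

variable {E : Type*} [NormedAddCommGroup E] [InnerProductSpace ℂ E]

theorem inner_self_eq_ofReal (x : E) : inner ℂ x x = ((‖x‖ ^ 2 : ℝ) : ℂ) := by
  rw [inner_self_eq_norm_sq_to_K]; push_cast; rfl

/-- The orthogonal projection onto a complex line in the direction of a unit vector. -/
noncomputable abbrev lineProj (x : E) : E →L[ℂ] E := rankOne ℂ x x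

theorem lineProj_smul (c : ℂ) (x : E) : lineProj (c • x) = ((‖c‖ ^ 2 : ℝ) : ℂ) • lineProj x := by
  ext y
  simp only [lineProj, rankOne_apply, inner_smul_left, smul_smul, smul_apply]
  congr 1
  rw [mul_right_comm, mul_comm _ c, Complex.mul_conj, Complex.normSq_eq_norm_sq]

/-- The squared length of the projection of a unit vector `e`. -/
noncomputable def height (e : E) (P : E →L[ℂ] E) : ℝ := (inner ℂ e (P e)).re

/-- The part of a projection that is orthogonal to `e`. -/
noncomputable def core (e : E) (P : E →L[ℂ] E) : E →L[ℂ] E :=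
  P - (((height e P)⁻¹ : ℝ) : ℂ) • lineProj (P e)

/-- The unit vector in the direction of the component of `P e` that is orthogonal to `e`. -/
noncomputable def direction (e : E) (P : E →L[ℂ] E) : E :=
  (((√(height e P * (1 - height e P)))⁻¹ : ℝ) : ℂ) • (P e - (height e P : ℂ) • e)

/-- The projection `A`, enlarged by the line through `a e + b u`. -/
noncomputable def enlarge (e : E) (A : E →L[ℂ] E) (u : E) (a b : ℝ) : E →L[ℂ] E :=
  A + lineProj ((a : ℂ) • e + (b : ℂ) • u)

/-- The normalised vector `μ^(-1/2) P e` equals `√μ e + √(1-μ) u`, so enlarging puts back exactly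
the line that `core` removed. Only `0 < μ < 1` matters here; `P` may be any operator. -/
theorem enlarge_core_direction {P : E →L[ℂ] E} {e : E}
    (h0 : 0 < height e P) (h1 : height e P < 1) :
    enlarge e (core e P) (direction e P) (√(height e P)) (√(1 - height e P)) = P := by
  set μ := height e P with hμ
  have hs : 0 < √μ := Real.sqrt_pos.2 h0
  have hs' : 0 < √(1 - μ) := Real.sqrt_pos.2 (by linarith)
  have hc : (√μ : ℂ) ≠ 0 := by exact_mod_cast hs.ne'
  have hc' : (√(1 - μ) : ℂ) ≠ 0 := by exact_mod_cast hs'.ne'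
  have h2 : (μ : ℂ) = (√μ : ℂ) * √μ := by
    rw [← Complex.ofReal_mul, Real.mul_self_sqrt h0.le]
  have hv : (√μ : ℂ) • e + (√(1 - μ) : ℂ) • direction e P = (((√μ)⁻¹ : ℝ) : ℂ) • P e := by
    rw [direction, ← hμ, smul_smul, Real.sqrt_mul h0.le]
    rw [show (√(1 - μ) : ℂ) * (((√μ * √(1 - μ))⁻¹ : ℝ) : ℂ) = (√μ : ℂ)⁻¹ by
      push_cast; field_simp]
    rw [smul_sub, smul_smul, h2, inv_mul_cancel_left₀ hc]
    push_cast
    abel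
  rw [enlarge, hv, lineProj_smul, core, ← hμ]
  rw [Complex.norm_real, Real.norm_eq_abs, sq_abs, inv_pow, Real.sq_sqrt h0.le]
  abel

variable [CompleteSpace E]

theorem isStarProjection_of_apply {P : E →L[ℂ] E} (h : ∀ x, P (P x) = P x)
    (h' : ∀ x y, inner ℂ (P x) y = inner ℂ x (P y)) : IsStarProjection P where
  isIdempotentElem := by ext x; exact h x
  isSelfAdjoint := ContinuousLinearMap.isSelfAdjoint_iff_isSymmetric.2 h'

theorem _root_.IsStarProjection.apply_apply {P : E →L[ℂ] E} (h : IsStarProjection P) (x : E) :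
    P (P x) = P x :=
  congrArg (fun Q : E →L[ℂ] E => Q x) h.isIdempotentElem

theorem _root_.IsStarProjection.inner_apply {P : E →L[ℂ] E} (h : IsStarProjection P) (x y : E) :
    inner ℂ (P x) y = inner ℂ x (P y) :=
  ContinuousLinearMap.isSelfAdjoint_iff_isSymmetric.1 h.isSelfAdjoint x y

theorem isStarProjection_add_lineProj {A : E →L[ℂ] E} (hA : IsStarProjection A) {x : E}
    (hx : A x = 0) (h1 : ‖x‖ = 1) : IsStarProjection (A + lineProj x) := by
  have hxy : ∀ y, inner ℂ x (A y) = 0 := fun y => by rw [← hA.inner_apply, hx, inner_zero_left]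
  refine isStarProjection_of_apply (fun y => ?_) (fun y z => ?_)
  · simp [hA.apply_apply, hx, hxy, inner_add_right, inner_smul_right, h1]
  · simp [hA.inner_apply]

theorem isStarProjection_sub_lineProj {A : E →L[ℂ] E} (hA : IsStarProjection A) {x : E}
    (hx : A x = x) (h1 : ‖x‖ = 1) : IsStarProjection (A - lineProj x) := by
  have hxy : ∀ y, inner ℂ x (A y) = inner ℂ x y := fun y => by rw [← hA.inner_apply, hx]
  refine isStarProjection_of_apply (fun y => ?_) (fun y z => ?_)
  · simp [hA.apply_apply, hx, hxy, inner_sub_right, inner_smul_right, h1]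
  · simp [hA.inner_apply]

theorem inner_apply_eq_height {P : E →L[ℂ] E} (hP : IsStarProjection P) (e : E) :
    inner ℂ e (P e) = (height e P : ℂ) := by
  have h : inner ℂ e (P e) = inner ℂ (P e) (P e) := by
    rw [hP.inner_apply, hP.apply_apply]
  rw [height, h, inner_self_eq_norm_sq_to_K]
  norm_cast

theorem norm_apply_sq {P : E →L[ℂ] E} (hP : IsStarProjection P) (e : E) :
    ‖P e‖ ^ 2 = height e P := by
  have h : inner ℂ e (P e) = inner ℂ (P e) (P e) := by
    rw [hP.inner_apply, hP.apply_apply]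
  rw [inner_apply_eq_height hP, inner_self_eq_ofReal] at h
  exact Complex.ofReal_injective h.symm

theorem height_nonneg {P : E →L[ℂ] E} (hP : IsStarProjection P) (e : E) : 0 ≤ height e P :=
  norm_apply_sq hP e ▸ sq_nonneg _

theorem norm_sub_apply_sq {P : E →L[ℂ] E} (hP : IsStarProjection P) {e : E} (he : ‖e‖ = 1) :
    ‖e - P e‖ ^ 2 = 1 - height e P := by
  have := norm_apply_sq hP.one_sub e
  rw [height] at this
  rw [show e - P e = (1 - P) e by simp, this]
  simp [he, height]

theorem height_le_one {P : E →L[ℂ] E} (hP : IsStarProjection P) {e : E} (he : ‖e‖ = 1) :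
    height e P ≤ 1 := by
  have := norm_sub_apply_sq hP he
  nlinarith [sq_nonneg ‖e - P e‖]

theorem apply_eq_zero_of_height {P : E →L[ℂ] E} (hP : IsStarProjection P) {e : E}
    (h : height e P = 0) : P e = 0 := by
  have := norm_apply_sq hP e
  rw [h] at this
  simpa using this

theorem apply_eq_self_of_height {P : E →L[ℂ] E} (hP : IsStarProjection P) {e : E} (he : ‖e‖ = 1)
    (h : height e P = 1) : P e = e := by
  have := norm_sub_apply_sq hP he
  rw [h, sub_self] at this
  exact (sub_eq_zero.1 (by simpa using this)).symm

/-- A projection `A` and a unit vector `u`, such that the unit vector `e`, the vector `u` and the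
range of `A` are orthogonal to each other. -/
structure IsFrame (e : E) (A : E →L[ℂ] E) (u : E) : Prop where
  norm_e : ‖e‖ = 1
  proj : IsStarProjection A
  map_e : A e = 0
  map_u : A u = 0
  norm_u : ‖u‖ = 1
  inner_e_u : inner ℂ e u = 0

namespace IsFrame

variable {e u : E} {A : E →L[ℂ] E}

theorem inner_u_e (h : IsFrame e A u) : inner ℂ u e = 0 := inner_eq_zero_symm.1 h.inner_e_u

theorem norm_comb_sq (h : IsFrame e A u) (a b : ℝ) :
    ‖(a : ℂ) • e + (b : ℂ) • u‖ ^ 2 = a ^ 2 + b ^ 2 := by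
  have := norm_add_sq_eq_norm_sq_add_norm_sq_of_inner_eq_zero (𝕜 := ℂ) ((a : ℂ) • e)
    ((b : ℂ) • u) (by simp [-Complex.coe_smul, inner_smul_left, inner_smul_right, h.inner_e_u])
  rw [sq, this]
  simp [norm_smul, h.norm_e, h.norm_u, sq]

theorem norm_comb (h : IsFrame e A u) {a b : ℝ} (hab : a ^ 2 + b ^ 2 = 1) :
    ‖(a : ℂ) • e + (b : ℂ) • u‖ = 1 := by
  have := h.norm_comb_sq a b
  rw [hab] at this
  exact (pow_eq_one_iff_of_nonneg (norm_nonneg _) two_ne_zero).1 this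

theorem isStarProjection_enlarge (h : IsFrame e A u) {a b : ℝ} (hab : a ^ 2 + b ^ 2 = 1) :
    IsStarProjection (enlarge e A u a b) :=
  isStarProjection_add_lineProj h.proj (by simp [h.map_e, h.map_u]) (h.norm_comb hab)

theorem enlarge_apply_e (h : IsFrame e A u) (a b : ℝ) :
    enlarge e A u a b e = (a : ℂ) • ((a : ℂ) • e + (b : ℂ) • u) := by
  simp [-Complex.coe_smul, enlarge, h.map_e, h.inner_u_e, h.norm_e,
    smul_comm (b : ℂ) (a : ℂ) u]

theorem height_enlarge (h : IsFrame e A u) (a b : ℝ) : height e (enlarge e A u a b) = a ^ 2 := by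
  rw [height, h.enlarge_apply_e]
  simp only [inner_smul_right, inner_add_right, inner_self_eq_norm_sq_to_K, h.norm_e, h.inner_e_u]
  norm_cast
  simp [sq]

/-- The enlarged projection sends `e` to `a (a e + b u)` and has height `a²`, so the rank-one term
subtracted by `core` is the line that was added. For `a = 0` the vector `e` no longer detects that
line. -/
theorem core_enlarge (h : IsFrame e A u) {a : ℝ} (b : ℝ) (ha : a ≠ 0) :
    core e (enlarge e A u a b) = A := by
  have ha' : (a : ℂ) ≠ 0 := by exact_mod_cast ha
  have h1 : lineProj ((a : ℂ) • ((a : ℂ) • e + (b : ℂ) • u)) =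
      ((a ^ 2 : ℝ) : ℂ) • lineProj ((a : ℂ) • e + (b : ℂ) • u) := by
    ext x
    simp only [lineProj, rankOne_apply, inner_smul_left, smul_smul, smul_apply]
    congr 1
    simp
    ring
  rw [core, h.height_enlarge, h.enlarge_apply_e, h1, smul_smul, enlarge]
  rw [show (((a ^ 2)⁻¹ : ℝ) : ℂ) * ((a ^ 2 : ℝ) : ℂ) = 1 by push_cast; field_simp, one_smul]
  simp

theorem direction_enlarge (h : IsFrame e A u) {a b : ℝ} (hab : a ^ 2 + b ^ 2 = 1) (ha : 0 < a)
    (hb : 0 < b) : direction e (enlarge e A u a b) = u := by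
  have h1 : a ^ 2 * (1 - a ^ 2) = (a * b) ^ 2 := by rw [← hab]; ring
  have ha' : (a : ℂ) ≠ 0 := by exact_mod_cast ha.ne'
  have hb' : (b : ℂ) ≠ 0 := by exact_mod_cast hb.ne'
  rw [direction, h.height_enlarge, h.enlarge_apply_e, h1, Real.sqrt_sq (by positivity)]
  rw [smul_add, smul_smul, smul_smul, show (a : ℂ) * a = ((a ^ 2 : ℝ) : ℂ) by push_cast; ring,
    add_sub_cancel_left, smul_smul]
  rw [show (((a * b)⁻¹ : ℝ) : ℂ) * ((a : ℂ) * b) = 1 by push_cast; field_simp, one_smul]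

end IsFrame

/-- `core` subtracts the projection onto the unit vector `μ^(-1/2) P e` of the range of `P`, so it
is again a projection. It kills both `e` and `P e`, hence `u`; and `‖P e - μ e‖² = μ (1 - μ)`
explains the normalisation of `direction`. -/
theorem isFrame_core_direction {P : E →L[ℂ] E} (hP : IsStarProjection P) {e : E} (he : ‖e‖ = 1)
    (h0 : 0 < height e P) (h1 : height e P < 1) : IsFrame e (core e P) (direction e P) := by
  set μ := height e P with hμ
  have hin := inner_apply_eq_height hP e
  have hin' : inner ℂ (P e) e = (μ : ℂ) := by rw [hP.inner_apply, hin]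
  have hPP : inner ℂ (P e) (P e) = (μ : ℂ) := by rw [hP.inner_apply, hP.apply_apply, hin]
  have hμ' : (μ : ℂ) ≠ 0 := by exact_mod_cast h0.ne'
  have hee : inner ℂ e e = (1 : ℂ) := by rw [inner_self_eq_norm_sq_to_K, he]; simp
  have hs : 0 < √(μ * (1 - μ)) := Real.sqrt_pos.2 (by nlinarith)
  have hcore : core e P = P - lineProj (((√μ)⁻¹ : ℝ) • P e) := by
    rw [core, ← hμ, ← Complex.coe_smul (x := (√μ)⁻¹), lineProj_smul]
    congr 3
    rw [Complex.norm_real, Real.norm_eq_abs, sq_abs, inv_pow, Real.sq_sqrt h0.le]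
  have hnorm : ‖P e‖ = √μ := by rw [hμ, ← norm_apply_sq hP, Real.sqrt_sq (norm_nonneg _)]
  have hce : core e P e = 0 := by
    simp only [core, sub_apply, smul_apply,
      rankOne_apply, hin', smul_smul, ← hμ]
    rw [show ((μ⁻¹ : ℝ) : ℂ) * μ = 1 by push_cast; field_simp, one_smul, sub_self]
  have hcp : core e P (P e) = 0 := by
    simp only [core, sub_apply, smul_apply,
      rankOne_apply, hPP, smul_smul, ← hμ, hP.apply_apply]
    rw [show ((μ⁻¹ : ℝ) : ℂ) * μ = 1 by push_cast; field_simp, one_smul, sub_self]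
  refine ⟨he, ?_, hce, ?_, ?_, ?_⟩
  · rw [hcore]
    refine isStarProjection_sub_lineProj hP ?_ ?_
    · rw [← Complex.coe_smul, map_smul, hP.apply_apply]
    · rw [norm_smul, hnorm, Real.norm_of_nonneg (by positivity)]
      exact inv_mul_cancel₀ (Real.sqrt_pos.2 h0).ne'
  · rw [direction, map_smul, map_sub, map_smul, hcp, hce]; simp
  · have h2 : ‖P e - (μ : ℂ) • e‖ ^ 2 = μ * (1 - μ) := by
      have : inner ℂ (P e - (μ : ℂ) • e) (P e - (μ : ℂ) • e) = ((μ * (1 - μ) : ℝ) : ℂ) := by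
        simp only [inner_sub_left, inner_sub_right, inner_smul_left, inner_smul_right, hPP, hin,
          hin', hee, Complex.conj_ofReal, ← hμ]
        push_cast; ring
      rw [inner_self_eq_ofReal] at this
      exact Complex.ofReal_injective this
    rw [direction, norm_smul, Complex.norm_real, Real.norm_of_nonneg (by positivity), ← hμ, ← h2,
      Real.sqrt_sq (norm_nonneg _)]
    refine inv_mul_cancel₀ fun h => ?_
    rw [h] at h2
    nlinarith
  · simp [-Complex.coe_smul, direction, hin, ← hμ, he]

theorem trace_enlarge [FiniteDimensional ℂ E] {e u : E} {A : E →L[ℂ] E} (h : IsFrame e A u)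
    {a b : ℝ} (hab : a ^ 2 + b ^ 2 = 1) :
    LinearMap.trace ℂ E (enlarge e A u a b : E →ₗ[ℂ] E) =
      LinearMap.trace ℂ E (A : E →ₗ[ℂ] E) + 1 := by
  rw [enlarge, ContinuousLinearMap.toLinearMap_add, map_add, trace_rankOne,
    inner_self_eq_norm_sq_to_K, h.norm_comb hab]
  simp

end Projections

/-! ### Equivariance under unitaries that have `e` as an eigenvector -/

section Conjugation

variable {E : Type*} [NormedAddCommGroup E] [InnerProductSpace ℂ E]

/-- Conjugation of an operator by a unitary operator. -/
noncomputable def conjBy (U : E ≃ₗᵢ[ℂ] E) (P : E →L[ℂ] E) : E →L[ℂ] E :=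
  (U : E →L[ℂ] E) ∘L P ∘L (U.symm : E →L[ℂ] E)

@[simp] theorem conjBy_apply (U : E ≃ₗᵢ[ℂ] E) (P : E →L[ℂ] E) (x : E) :
    conjBy U P x = U (P (U.symm x)) := rfl

theorem conjBy_lineProj (U : E ≃ₗᵢ[ℂ] E) (x : E) : conjBy U (lineProj x) = lineProj (U x) := by
  ext y
  simp only [conjBy_apply, rankOne_apply, map_smul]
  rw [← U.inner_map_map x, U.apply_symm_apply]

theorem isStarProjection_conjBy [CompleteSpace E] (U : E ≃ₗᵢ[ℂ] E) {P : E →L[ℂ] E}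
    (hP : IsStarProjection P) : IsStarProjection (conjBy U P) := by
  refine isStarProjection_of_apply (fun x => ?_) (fun x y => ?_)
  · simp [hP.apply_apply]
  · rw [conjBy_apply, conjBy_apply, ← U.symm.inner_map_map, U.symm_apply_apply, hP.inner_apply,
      ← U.inner_map_map, U.apply_symm_apply]

variable {e : E} {U : E ≃ₗᵢ[ℂ] E} {c : ℂ}

theorem symm_apply_of_eigenvector (hU : U e = c • e) (hc : ‖c‖ = 1) : U.symm e = c⁻¹ • e := by
  have hc0 : c ≠ 0 := by rintro rfl; simp at hc
  rw [U.symm_apply_eq, map_smul, hU, inv_smul_smul₀ hc0]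

theorem conjBy_apply_eigenvector (hU : U e = c • e) (hc : ‖c‖ = 1) (P : E →L[ℂ] E) :
    conjBy U P e = c⁻¹ • U (P e) := by
  simp [symm_apply_of_eigenvector hU hc]

theorem height_conjBy (hU : U e = c • e) (hc : ‖c‖ = 1) (P : E →L[ℂ] E) :
    height e (conjBy U P) = height e P := by
  have hc0 : c ≠ 0 := by rintro rfl; simp at hc
  rw [height, height, conjBy_apply, ← U.symm.inner_map_map, U.symm_apply_apply,
    symm_apply_of_eigenvector hU hc, map_smul, inner_smul_left, inner_smul_right, ← mul_assoc,
    mul_comm _ c⁻¹, Complex.mul_conj, Complex.normSq_eq_norm_sq]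
  simp [hc]

theorem core_conjBy (hU : U e = c • e) (hc : ‖c‖ = 1) (P : E →L[ℂ] E) :
    core e (conjBy U P) = conjBy U (core e P) := by
  rw [core, height_conjBy hU hc, conjBy_apply_eigenvector hU hc, lineProj_smul, norm_inv, hc,
    ← conjBy_lineProj]
  ext x
  simp [core]

theorem direction_conjBy (hU : U e = c • e) (hc : ‖c‖ = 1) (P : E →L[ℂ] E) :
    direction e (conjBy U P) = c⁻¹ • U (direction e P) := by
  have hc0 : c ≠ 0 := by rintro rfl; simp at hc
  rw [direction, height_conjBy hU hc, conjBy_apply_eigenvector hU hc, direction]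
  rw [map_smul, smul_comm c⁻¹, map_sub, map_smul, hU, smul_sub c⁻¹, smul_comm c⁻¹ (height e P : ℂ),
    inv_smul_smul₀ hc0]

/-- The direction changes to `c⁻¹ U u` because it is normalised against the fixed vector `e`. The
added vector is then `c⁻¹ U (a e + b u)`, and the phase `c⁻¹` does not affect the line. -/
theorem enlarge_conjBy (hU : U e = c • e) (hc : ‖c‖ = 1) (A : E →L[ℂ] E) (u : E) (a b : ℝ) :
    enlarge e (conjBy U A) (c⁻¹ • U u) a b = conjBy U (enlarge e A u a b) := by
  have hc0 : c ≠ 0 := by rintro rfl; simp at hc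
  have h : (a : ℂ) • e + (b : ℂ) • c⁻¹ • U u = c⁻¹ • U ((a : ℂ) • e + (b : ℂ) • u) := by
    rw [map_add, map_smul, map_smul, hU, smul_add, smul_comm (a : ℂ) c, inv_smul_smul₀ hc0,
      smul_comm (b : ℂ)]
  rw [enlarge, h, lineProj_smul, norm_inv, hc, ← conjBy_lineProj, enlarge]
  ext x
  simp [-Complex.coe_smul]

/-- The projection which is obtained from `P` by replacing the line through `P e` by the line that
is spanned by `a e + b u`, where `u` is the direction of the component of `P e` orthogonal to
`e`. -/
noncomputable def rotate (e : E) (P : E →L[ℂ] E) (a b : ℝ) : E →L[ℂ] E :=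
  enlarge e (core e P) (direction e P) a b

theorem rotate_conjBy (hU : U e = c • e) (hc : ‖c‖ = 1) (P : E →L[ℂ] E) (a b : ℝ) :
    rotate e (conjBy U P) a b = conjBy U (rotate e P a b) := by
  rw [rotate, core_conjBy hU hc, direction_conjBy hU hc, enlarge_conjBy hU hc, rotate]

end Conjugation

/-! ## Subspaces and projections -/

namespace Gr

variable {n k : ℕ}

theorem isStarProjection_proj (L : Gr n k) : IsStarProjection L.proj :=
  isStarProjection_starProjection

theorem range_proj (L : Gr n k) : L.proj.range = L.1 :=
  Submodule.range_starProjection L.1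

theorem proj_injective : Function.Injective (proj : Gr n k → CSpace n →L[ℂ] CSpace n) := by
  intro L M h
  apply Subtype.ext
  rw [← range_proj, h, range_proj]

theorem proj_eq {L : Gr n k} {P : CSpace n →L[ℂ] CSpace n} (hP : IsStarProjection P)
    (h : P.range = L.1) : L.proj = P :=
  (ContinuousLinearMap.IsStarProjection.ext_iff L.isStarProjection_proj hP).2
    (by rw [range_proj, h])

/-- The trace turns the dimension condition into one that is linear in `P`: it is closed, and
additive when lines are added or removed. -/
theorem trace_eq_finrank_range {P : CSpace n →L[ℂ] CSpace n} (hP : IsStarProjection P) :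
    LinearMap.trace ℂ _ (P : CSpace n →ₗ[ℂ] CSpace n) = Module.finrank ℂ P.range := by
  refine LinearMap.IsProj.trace (p := P.range) ⟨fun x => ⟨x, rfl⟩, ?_⟩
  rintro _ ⟨x, rfl⟩
  exact hP.apply_apply x

theorem trace_proj (L : Gr n k) :
    LinearMap.trace ℂ _ (L.proj : CSpace n →ₗ[ℂ] CSpace n) = k := by
  rw [trace_eq_finrank_range L.isStarProjection_proj, range_proj, L.2]

/-- The range of an orthogonal projection of trace `k`, as a point of `G_{n,k}`. -/
noncomputable def ofProj (P : CSpace n →L[ℂ] CSpace n) (hP : IsStarProjection P)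
    (htr : LinearMap.trace ℂ _ (P : CSpace n →ₗ[ℂ] CSpace n) = k) : Gr n k :=
  ⟨P.range, by rw [trace_eq_finrank_range hP] at htr; exact_mod_cast htr⟩

@[simp] theorem proj_ofProj (P : CSpace n →L[ℂ] CSpace n) (hP : IsStarProjection P)
    (htr : LinearMap.trace ℂ _ (P : CSpace n →ₗ[ℂ] CSpace n) = k) : (ofProj P hP htr).proj = P :=
  proj_eq hP rfl

theorem isEmbedding_proj :
    Topology.IsEmbedding (proj : Gr n k → CSpace n →L[ℂ] CSpace n) :=
  ⟨⟨rfl⟩, proj_injective⟩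

theorem continuous_proj : Continuous (proj : Gr n k → CSpace n →L[ℂ] CSpace n) :=
  isEmbedding_proj.continuous

instance : T2Space (Gr n k) := isEmbedding_proj.t2Space

theorem range_proj_eq :
    Set.range (proj : Gr n k → CSpace n →L[ℂ] CSpace n) =
      {P : CSpace n →L[ℂ] CSpace n | P * P = P ∧ star P = P ∧
        LinearMap.trace ℂ _ (P : CSpace n →ₗ[ℂ] CSpace n) = k} := by
  ext P
  constructor
  · rintro ⟨L, rfl⟩
    exact ⟨L.isStarProjection_proj.isIdempotentElem, L.isStarProjection_proj.isSelfAdjoint,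
      L.trace_proj⟩
  · rintro ⟨h1, h2, h3⟩
    exact ⟨ofProj P ⟨h1, h2⟩ h3, proj_ofProj _ _ _⟩

theorem isCompact_range_proj :
    IsCompact (Set.range (proj : Gr n k → CSpace n →L[ℂ] CSpace n)) := by
  have : ProperSpace (CSpace n →L[ℂ] CSpace n) := FiniteDimensional.proper ℂ _
  refine Metric.isCompact_of_isClosed_isBounded ?_ ?_
  · rw [range_proj_eq]
    refine (isClosed_eq (by fun_prop) continuous_id).inter
      ((isClosed_eq ContinuousLinearMap.adjoint.continuous continuous_id).inter
        (isClosed_eq ?_ continuous_const))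
    exact ((LinearMap.trace ℂ (CSpace n)).comp
      (ContinuousLinearMap.coeLM ℂ)).continuous_of_finiteDimensional
  · refine (Metric.isBounded_closedBall (x := 0) (r := 1)).subset ?_
    rintro _ ⟨L, rfl⟩
    rw [mem_closedBall_zero_iff]
    exact L.isStarProjection_proj.norm_le

instance : CompactSpace (Gr n k) := by
  rw [← isCompact_univ_iff, isEmbedding_proj.isCompact_iff, Set.image_univ]
  exact isCompact_range_proj

end Gr

/-! ## The torus action on projections -/

/-- The unitary operator by which an element of the torus acts. -/
noncomputable def Torus.unitary {n : ℕ} (t : Torus n) : CSpace n ≃ₗᵢ[ℂ] CSpace n where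
  toLinearEquiv := t.lin
  norm_map' x := by
    rw [EuclideanSpace.norm_eq, EuclideanSpace.norm_eq]
    simp [Torus.lin, Circle.norm_coe]

@[simp] theorem Torus.unitary_apply {n : ℕ} (t : Torus n) (x : CSpace n) (i : Fin n) :
    t.unitary x i = t i * x i := rfl

@[simp] theorem Torus.unitary_symm_apply {n : ℕ} (t : Torus n) (x : CSpace n) (i : Fin n) :
    t.unitary.symm x i = ((t i)⁻¹ : Circle) * x i := rfl

theorem Torus.unitary_single {n : ℕ} (t : Torus n) (j : Fin n) :
    t.unitary (EuclideanSpace.single j (1 : ℂ)) = (t j : ℂ) • EuclideanSpace.single j (1 : ℂ) := by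
  ext i
  by_cases h : i = j
  · subst h; simp
  · simp [h]

theorem Gr.proj_smul {n k : ℕ} (t : Torus n) (L : Gr n k) :
    (t • L).proj = conjBy t.unitary L.proj := by
  refine Gr.proj_eq (isStarProjection_conjBy _ L.isStarProjection_proj) ?_
  change _ = L.1.map (t.lin : CSpace n →ₗ[ℂ] CSpace n)
  ext x
  constructor
  · rintro ⟨y, rfl⟩
    exact ⟨_, L.range_proj ▸ ⟨t.unitary.symm y, rfl⟩, rfl⟩
  · rintro ⟨y, hy, rfl⟩
    rw [SetLike.mem_coe, ← L.range_proj] at hy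
    obtain ⟨z, rfl⟩ := hy
    exact ⟨t.unitary z, by simp; rfl⟩

/-! ## The coordinate embeddings on projections -/

section Coordinates

variable {n : ℕ} (j : Fin (n + 1))

/-- The `j`-th coordinate vector. -/
noncomputable abbrev coordVec : CSpace (n + 1) := EuclideanSpace.single j 1

/-- The coordinate embedding as a continuous linear map. -/
noncomputable def coordL : CSpace n →L[ℂ] CSpace (n + 1) := (coordIncl j).toContinuousLinearMap

/-- The projection `ℂⁿ⁺¹ → ℂⁿ` which drops the `j`-th coordinate. -/
noncomputable def coordDrop : CSpace (n + 1) →L[ℂ] CSpace n :=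
  LinearMap.toContinuousLinearMap
    { toFun := fun z => WithLp.toLp 2 fun i => z (j.succAbove i)
      map_add' := fun x y => by ext i; simp
      map_smul' := fun c x => by ext i; simp }

@[simp] theorem coordL_apply_same (z : CSpace n) : coordL j z j = 0 := coordIncl_apply_same j z

@[simp] theorem coordL_apply_succAbove (z : CSpace n) (i : Fin n) :
    coordL j z (j.succAbove i) = z i := coordIncl_apply_succAbove j z i

@[simp] theorem coordDrop_apply (z : CSpace (n + 1)) (i : Fin n) :
    coordDrop j z i = z (j.succAbove i) := rfl

@[simp] theorem coordDrop_coordL (z : CSpace n) : coordDrop j (coordL j z) = z := by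
  ext i; simp

@[simp] theorem coordDrop_coordVec : coordDrop j (coordVec j) = 0 := by
  ext i; simp [Fin.succAbove_ne]

@[simp] theorem inner_coordVec (z : CSpace (n + 1)) : inner ℂ (coordVec j) z = z j := by
  simp [EuclideanSpace.inner_single_left]

theorem coordL_coordDrop (z : CSpace (n + 1)) :
    coordL j (coordDrop j z) = z - z j • coordVec j := by
  ext i
  refine j.succAboveCases ?_ (fun i => ?_) i
  · simp
  · simp [Fin.succAbove_ne]

theorem inner_coordL (x : CSpace n) (y : CSpace (n + 1)) :
    inner ℂ (coordL j x) y = inner ℂ x (coordDrop j y) := by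
  simp [PiLp.inner_apply, Fin.sum_univ_succAbove _ j]

theorem inner_coordDrop (x : CSpace (n + 1)) (y : CSpace n) :
    inner ℂ (coordDrop j x) y = inner ℂ x (coordL j y) := by
  rw [← inner_conj_symm, ← inner_coordL, inner_conj_symm]

theorem norm_coordL (x : CSpace n) : ‖coordL j x‖ = ‖x‖ := by
  rw [← sq_eq_sq₀ (norm_nonneg _) (norm_nonneg _), ← Complex.ofReal_inj, ← inner_self_eq_ofReal,
    ← inner_self_eq_ofReal, inner_coordL, coordDrop_coordL]

/-- The operator on `ℂⁿ⁺¹` which extends an operator on the coordinate subspace `ℂⁿ` by zero. -/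
noncomputable def embedOp (A : CSpace n →L[ℂ] CSpace n) : CSpace (n + 1) →L[ℂ] CSpace (n + 1) :=
  coordL j ∘L A ∘L coordDrop j

/-- The compression of an operator on `ℂⁿ⁺¹` to the coordinate subspace `ℂⁿ`. -/
noncomputable def compressOp (A : CSpace (n + 1) →L[ℂ] CSpace (n + 1)) :
    CSpace n →L[ℂ] CSpace n :=
  coordDrop j ∘L A ∘L coordL j

@[simp] theorem embedOp_apply (A : CSpace n →L[ℂ] CSpace n) (x : CSpace (n + 1)) :
    embedOp j A x = coordL j (A (coordDrop j x)) := rfl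

@[simp] theorem compressOp_apply (A : CSpace (n + 1) →L[ℂ] CSpace (n + 1)) (x : CSpace n) :
    compressOp j A x = coordDrop j (A (coordL j x)) := rfl

@[simp] theorem compressOp_embedOp (A : CSpace n →L[ℂ] CSpace n) :
    compressOp j (embedOp j A) = A := by
  ext1 x; simp

variable {j}

theorem isStarProjection_embedOp {A : CSpace n →L[ℂ] CSpace n} (hA : IsStarProjection A) :
    IsStarProjection (embedOp j A) :=
  isStarProjection_of_apply (fun x => by simp [hA.apply_apply])
    (fun x y => by simp [inner_coordL, hA.inner_apply, inner_coordDrop])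

/-- A self-adjoint operator that kills `e` also has its range in `e^⊥`, so compression to the
coordinate subspace loses nothing. -/
theorem embedOp_compressOp {A : CSpace (n + 1) →L[ℂ] CSpace (n + 1)} (hA : IsStarProjection A)
    (h : A (coordVec j) = 0) : embedOp j (compressOp j A) = A := by
  ext1 x
  have : A x j = 0 := by rw [← inner_coordVec, ← hA.inner_apply, h, inner_zero_left]
  simp [coordL_coordDrop, h, this]

theorem isStarProjection_compressOp {A : CSpace (n + 1) →L[ℂ] CSpace (n + 1)}
    (hA : IsStarProjection A) (h : A (coordVec j) = 0) : IsStarProjection (compressOp j A) := by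
  refine isStarProjection_of_apply (fun x => ?_)
    (fun x y => by simp [inner_coordL, hA.inner_apply, inner_coordDrop])
  have := congrArg (fun B : CSpace (n + 1) →L[ℂ] CSpace (n + 1) => coordDrop j (B (A (coordL j x))))
    (embedOp_compressOp hA h)
  simpa [hA.apply_apply] using this

theorem trace_embedOp (A : CSpace n →L[ℂ] CSpace n) :
    LinearMap.trace ℂ _ (embedOp j A : CSpace (n + 1) →ₗ[ℂ] CSpace (n + 1)) =
      LinearMap.trace ℂ _ (A : CSpace n →ₗ[ℂ] CSpace n) := by
  rw [embedOp, ContinuousLinearMap.toLinearMap_comp, LinearMap.trace_comp_comm',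
    ← ContinuousLinearMap.toLinearMap_comp]
  congr 2
  ext1 x
  simp

theorem trace_compressOp {A : CSpace (n + 1) →L[ℂ] CSpace (n + 1)} (hA : IsStarProjection A)
    (h : A (coordVec j) = 0) :
    LinearMap.trace ℂ _ (compressOp j A : CSpace n →ₗ[ℂ] CSpace n) =
      LinearMap.trace ℂ _ (A : CSpace (n + 1) →ₗ[ℂ] CSpace (n + 1)) := by
  rw [← trace_embedOp (j := j), embedOp_compressOp hA h]

theorem proj_inclZero {k : ℕ} (L : Gr n k) : (inclZero j L).proj = embedOp j L.proj := by
  refine Gr.proj_eq (isStarProjection_embedOp L.isStarProjection_proj) ?_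
  change _ = L.1.map (coordIncl j)
  ext x
  constructor
  · rintro ⟨y, rfl⟩
    exact ⟨_, L.range_proj ▸ ⟨coordDrop j y, rfl⟩, rfl⟩
  · rintro ⟨y, hy, rfl⟩
    rw [SetLike.mem_coe, ← L.range_proj] at hy
    obtain ⟨z, rfl⟩ := hy
    exact ⟨coordL j z, by simp; rfl⟩

theorem proj_inclOne {k : ℕ} (L : Gr n k) :
    (inclOne j L).proj = embedOp j L.proj + lineProj (coordVec j) := by
  refine Gr.proj_eq (isStarProjection_add_lineProj
    (isStarProjection_embedOp L.isStarProjection_proj) (by simp) (by simp)) ?_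
  change _ = L.1.map (coordIncl j) ⊔ Submodule.span ℂ {coordVec j}
  ext x
  rw [Submodule.mem_sup]
  constructor
  · rintro ⟨y, rfl⟩
    exact ⟨_, ⟨_, L.range_proj ▸ ⟨coordDrop j y, rfl⟩, rfl⟩, _,
      Submodule.mem_span_singleton.2 ⟨inner ℂ (coordVec j) y, rfl⟩, rfl⟩
  · rintro ⟨_, ⟨y, hy, rfl⟩, _, hz, rfl⟩
    obtain ⟨c, rfl⟩ := Submodule.mem_span_singleton.1 hz
    rw [SetLike.mem_coe, ← L.range_proj] at hy
    obtain ⟨z, rfl⟩ := hy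
    exact ⟨coordL j z + c • coordVec j, by simp; rfl⟩

theorem inclZero_injective {k : ℕ} : Function.Injective (inclZero j : Gr n k → Gr (n + 1) k) := by
  intro L M h
  have := congrArg (fun L => compressOp j (Gr.proj L)) h
  simp only [proj_inclZero, compressOp_embedOp] at this
  exact Gr.proj_injective this

theorem inclOne_injective {k : ℕ} :
    Function.Injective (inclOne j : Gr n k → Gr (n + 1) (k + 1)) := by
  intro L M h
  have := congrArg (fun L => compressOp j (Gr.proj L - lineProj (coordVec j))) h
  simp only [proj_inclOne, add_sub_cancel_right, compressOp_embedOp] at this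
  exact Gr.proj_injective this

theorem embedOp_conjBy (t : Torus (n + 1)) (A : CSpace n →L[ℂ] CSpace n) :
    embedOp j (conjBy (t.drop j).unitary A) = conjBy t.unitary (embedOp j A) := by
  ext x i
  have h : (t.drop j).unitary.symm (coordDrop j x) = coordDrop j (t.unitary.symm x) := by
    ext i; simp [Torus.drop]
  refine j.succAboveCases ?_ (fun i => ?_) i <;> simp [h, Torus.drop]

theorem inclZero_smul {k : ℕ} (t : Torus (n + 1)) (L : Gr n k) :
    inclZero j (t.drop j • L) = t • inclZero j L := by
  apply Gr.proj_injective
  rw [proj_inclZero, Gr.proj_smul, Gr.proj_smul, proj_inclZero, embedOp_conjBy]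

theorem inclOne_smul {k : ℕ} (t : Torus (n + 1)) (L : Gr n k) :
    inclOne j (t.drop j • L) = t • inclOne j L := by
  apply Gr.proj_injective
  rw [proj_inclOne, Gr.proj_smul, Gr.proj_smul, proj_inclOne, embedOp_conjBy]
  have : conjBy t.unitary (lineProj (coordVec j)) = lineProj (coordVec j) := by
    rw [conjBy_lineProj, Torus.unitary_single, lineProj_smul, Circle.norm_coe]; simp
  nth_rw 1 [← this]
  ext1 x
  simp

end Coordinates

/-! ## Smoothness of the constructions with projections -/

section Smooth

variable {m : ℕ} {W : Type*} [NormedAddCommGroup W] [NormedSpace ℝ W]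

/-- `rankOne` is conjugate-linear in its second argument, hence bilinear over `ℝ`; `lineProj` is its
restriction to the diagonal. -/
theorem contDiff_lineProj : ContDiff ℝ ∞ (lineProj : CSpace m → CSpace m →L[ℂ] CSpace m) := by
  let B : CSpace m →L[ℝ] CSpace m →L[ℝ] CSpace m →L[ℂ] CSpace m :=
    LinearMap.mkContinuous₂ (LinearMap.mk₂ ℝ (fun x y : CSpace m => rankOne ℂ x y)
      (fun x x' y => by simp) (fun c x y => by
        ext1 z
        simp only [rankOne_apply, smul_apply]
        rw [smul_comm])
      (fun x y y' => by simp) (fun c x y => by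
        ext1 z
        simp only [rankOne_apply, smul_apply]
        rw [← Complex.coe_smul, inner_smul_left, ← Complex.coe_smul, smul_smul]
        simp)) 1 (fun x y => by simp)
  have h : ContDiff ℝ ∞ (fun x : CSpace m => B x x) :=
    B.contDiff.clm_apply contDiff_id
  exact h

/-- Evaluation at a vector, as a real linear map. -/
noncomputable def evalL (e : CSpace m) : (CSpace m →L[ℂ] CSpace m) →L[ℝ] CSpace m :=
  (ContinuousLinearMap.apply ℂ (CSpace m) e).restrictScalars ℝ

theorem contDiff_apply_vec (e : CSpace m) :
    ContDiff ℝ ∞ (fun P : CSpace m →L[ℂ] CSpace m => P e) :=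
  (evalL e).contDiff

theorem contDiff_height (e : CSpace m) :
    ContDiff ℝ ∞ (height e : (CSpace m →L[ℂ] CSpace m) → ℝ) :=
  (Complex.reCLM.comp (((innerSL ℂ e).restrictScalars ℝ).comp (evalL e))).contDiff

variable {e : CSpace m} {P : CSpace m →L[ℂ] CSpace m}

theorem contDiffAt_core (h0 : 0 < height e P) : ContDiffAt ℝ ∞ (core e) P := by
  have h1 : ContDiffAt ℝ ∞ (fun Q : CSpace m →L[ℂ] CSpace m => (height e Q)⁻¹) P :=
    (contDiff_height e).contDiffAt.inv h0.ne'
  have h2 : ContDiffAt ℝ ∞ (fun Q : CSpace m →L[ℂ] CSpace m => lineProj (Q e)) P :=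
    (contDiff_lineProj.comp (contDiff_apply_vec e)).contDiffAt
  refine (contDiffAt_id.sub (h1.smul h2)).congr_of_eventuallyEq (.of_forall fun Q => ?_)
  simp only [core, Complex.coe_smul]
  rfl

theorem contDiffAt_direction (h0 : 0 < height e P) (h1 : height e P < 1) :
    ContDiffAt ℝ ∞ (direction e) P := by
  have hp : 0 < height e P * (1 - height e P) := by nlinarith
  have hh : ContDiffAt ℝ ∞ (height e) P := (contDiff_height e).contDiffAt
  have h2 := ((hh.mul (contDiffAt_const.sub hh)).sqrt hp.ne').inv (Real.sqrt_pos.2 hp).ne'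
  refine (h2.smul ((contDiff_apply_vec e).contDiffAt.sub
    (hh.smul (contDiffAt_const (c := e))))).congr_of_eventuallyEq (.of_forall fun Q => ?_)
  simp only [direction, Complex.coe_smul]
  rfl

/-- The coefficients `a` and `b` may vanish; only the height of the operator that supplies the frame
must avoid 0 and 1. This gives smoothness of the end projections and continuity of the cylinder up
to its ends. -/
theorem contDiffAt_rotate {f : W → CSpace m →L[ℂ] CSpace m} {a b : W → ℝ} {w : W}
    (hf : ContDiffAt ℝ ∞ f w) (ha : ContDiffAt ℝ ∞ a w) (hb : ContDiffAt ℝ ∞ b w)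
    (h0 : 0 < height e (f w)) (h1 : height e (f w) < 1) :
    ContDiffAt ℝ ∞ (fun w => rotate e (f w) (a w) (b w)) w := by
  have h2 := (contDiffAt_core h0).comp w hf
  have h3 := (contDiffAt_direction h0 h1).comp w hf
  refine (h2.add (contDiff_lineProj.contDiffAt.comp w
    ((ha.smul (contDiffAt_const (c := e))).add (hb.smul h3)))).congr_of_eventuallyEq
    (.of_forall fun Q => ?_)
  simp only [rotate, enlarge, Complex.coe_smul]
  rfl

theorem contDiff_compressOp {n : ℕ} (j : Fin (n + 1)) : ContDiff ℝ ∞ (compressOp j) := by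
  have : ContDiff ℂ ∞ (compressOp j) := by unfold compressOp; fun_prop
  exact this.restrict_scalars ℝ

theorem continuous_embedOp {n : ℕ} (j : Fin (n + 1)) : Continuous (embedOp j) := by
  unfold embedOp; fun_prop

end Smooth

/-! ## Maps out of a glued space -/

namespace Glue

variable {X A B Z Y : Type*} {p : X → A} {q : X → B}

theorem cyl_zero (x : X) : cyl p q x 0 = left p q (p x) := Quot.sound (.zero x)

theorem cyl_one (x : X) : cyl p q x 1 = right p q (q x) := Quot.sound (.one x)

@[elab_as_elim]
theorem ind {motive : Glue p q → Prop} (hc : ∀ x t, motive (cyl p q x t))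
    (hl : ∀ a, motive (left p q a)) (hr : ∀ b, motive (right p q b)) (y : Glue p q) :
    motive y := by
  rcases y with ⟨⟨x, t⟩ | a | b⟩
  exacts [hc x t, hl a, hr b]

/-- Induction over the points of a glued space, where only the interior of the cylinder is
considered. -/
theorem ind_interior {motive : Glue p q → Prop}
    (hc : ∀ x (t : unitInterval), 0 < (t : ℝ) → (t : ℝ) < 1 → motive (cyl p q x t))
    (hl : ∀ a, motive (left p q a)) (hr : ∀ b, motive (right p q b)) (y : Glue p q) :
    motive y := by
  refine ind (fun x t => ?_) hl hr y
  rcases t.2.1.eq_or_lt with h | h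
  · rw [show t = 0 from Subtype.ext h.symm, cyl_zero]; exact hl _
  rcases t.2.2.eq_or_lt with h' | h'
  · rw [show t = 1 from Subtype.ext h', cyl_one]; exact hr _
  exact hc x t h h'

/-- The map out of a glued space that is given by compatible maps on the three pieces. -/
def desc (f : X × unitInterval → Z) (g : A → Z) (h : B → Z) (h0 : ∀ x, f (x, 0) = g (p x))
    (h1 : ∀ x, f (x, 1) = h (q x)) : Glue p q → Z :=
  Quot.lift (Sum.elim f (Sum.elim g h)) (by
    rintro _ _ (x | x)
    exacts [h0 x, h1 x])

/-! ## The prolonged cylinder -/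

variable (p q) in
/-- The cylinder of a glued space, prolonged by the track of a contraction of the space that is
glued on at the end `1`. -/
noncomputable def prolong (H : unitInterval × B → B) (x : X) (r : ℝ) : Glue p q :=
  if r ≤ 1 then cyl p q x (Set.projIcc 0 1 zero_le_one r)
  else right p q (H (Set.projIcc 0 1 zero_le_one (r - 1), q x))

theorem prolong_of_le (H : unitInterval × B → B) (x : X) {r : ℝ} (hr : r ≤ 1) :
    prolong p q H x r = cyl p q x (Set.projIcc 0 1 zero_le_one r) := if_pos hr

theorem prolong_of_ge {H : unitInterval × B → B} (hH : ∀ b, H (0, b) = b) (x : X) {r : ℝ}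
    (hr : 1 ≤ r) :
    prolong p q H x r = right p q (H (Set.projIcc 0 1 zero_le_one (r - 1), q x)) := by
  rcases hr.eq_or_lt with rfl | hr
  · rw [prolong_of_le _ _ le_rfl, sub_self, Set.projIcc_left, Set.projIcc_right]
    exact (cyl_one x).trans (congrArg _ (hH (q x)).symm)
  · exact if_neg hr.not_ge

variable [TopologicalSpace X] [TopologicalSpace A] [TopologicalSpace B] [TopologicalSpace Z]
  [TopologicalSpace Y]

theorem isQuotientMap_mk :
    Topology.IsQuotientMap (Y := Glue p q) (Quot.mk (GlueRel p q)) := isQuotientMap_quot_mk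

theorem continuous_iff {F : Glue p q → Z} :
    Continuous F ↔ Continuous (fun y : X × unitInterval => F (cyl p q y.1 y.2)) ∧
      Continuous (fun a => F (left p q a)) ∧ Continuous (fun b => F (right p q b)) := by
  rw [isQuotientMap_mk.continuous_iff, continuous_sum_dom, continuous_sum_dom]
  rfl

theorem continuous_cyl : Continuous (fun y : X × unitInterval => cyl p q y.1 y.2) :=
  (continuous_iff.1 continuous_id).1

theorem continuous_left : Continuous (left p q) := (continuous_iff.1 continuous_id).2.1

theorem continuous_right : Continuous (right p q) := (continuous_iff.1 continuous_id).2.2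

theorem continuous_desc {f : X × unitInterval → Z} {g : A → Z} {h : B → Z} (hf : Continuous f)
    (hg : Continuous g) (hh : Continuous h) (h0 : ∀ x, f (x, 0) = g (p x))
    (h1 : ∀ x, f (x, 1) = h (q x)) : Continuous (desc f g h h0 h1) :=
  continuous_iff.2 ⟨hf, hg, hh⟩

/-- The product of a quotient map with a locally compact space is again a quotient map. Taking `Y`
to be the unit interval allows homotopies to be defined piece by piece. -/
theorem continuous_prod_of [LocallyCompactSpace Y] {F : Y × Glue p q → Z}
    (hf : Continuous (fun y : Y × (X × unitInterval) => F (y.1, cyl p q y.2.1 y.2.2)))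
    (hg : Continuous (fun y : Y × A => F (y.1, left p q y.2)))
    (hh : Continuous (fun y : Y × B => F (y.1, right p q y.2))) : Continuous F := by
  refine isQuotientMap_mk.continuous_lift_prod_right ?_
  rw [← (Homeomorph.prodSumDistrib (X := Y) (Y := X × unitInterval)
    (Z := A ⊕ B)).symm.comp_continuous_iff', continuous_sum_dom]
  refine ⟨hf, ?_⟩
  rw [← (Homeomorph.prodSumDistrib (X := Y) (Y := A) (Z := B)).symm.comp_continuous_iff',
    continuous_sum_dom]
  exact ⟨hg, hh⟩

instance [CompactSpace X] [CompactSpace A] [CompactSpace B] : CompactSpace (Glue p q) :=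
  inferInstanceAs (CompactSpace (Quot (GlueRel p q)))

/-! ## Replacing a contractible end by a cone -/

theorem continuous_prolong (hq : Continuous q) {H : unitInterval × B → B} (hc : Continuous H)
    (hH : ∀ b, H (0, b) = b) : Continuous (fun y : X × ℝ => prolong p q H y.1 y.2) := by
  refine Continuous.if_le ?_ ?_ continuous_snd continuous_const ?_
  · exact continuous_cyl.comp (f := fun y : X × ℝ => (y.1, Set.projIcc 0 1 zero_le_one y.2))
      (continuous_fst.prodMk (continuous_projIcc.comp continuous_snd))
  · exact continuous_right.comp (hc.comp ((continuous_projIcc.comp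
      (continuous_snd.sub continuous_const)).prodMk (hq.comp continuous_fst)))
  · intro y hy
    rw [← prolong_of_le H _ hy.le, prolong_of_ge hH _ hy.ge]

/-- The map `f` collapses `B` to the apex. Its homotopy inverse `g` runs through the cylinder and
then along the track of `q x` under a contraction of `B`, at double speed. The cylinder itself
provides the room for the homotopies, so no cofibration hypothesis is needed. -/
theorem homotopyEquiv_attachCone (hq : Continuous q) [ContractibleSpace B] :
    Nonempty (ContinuousMap.HomotopyEquiv (Glue p q) (AttachCone p)) := by
  obtain ⟨b₀, ⟨H⟩⟩ := id_nullhomotopic B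
  have hH0 : ∀ b, H (0, b) = b := fun b => H.apply_zero b
  have hH1 : ∀ b, H (1, b) = b₀ := fun b => H.apply_one b
  have hEc := continuous_prolong (p := p) hq H.continuous hH0
  have hE0 : ∀ x, prolong p q H x 0 = left p q (p x) := fun x => by
    rw [prolong_of_le _ _ zero_le_one, Set.projIcc_left]; exact cyl_zero x
  have hEs : ∀ x (s : unitInterval), prolong p q H x (1 + s) = right p q (H (s, q x)) := by
    intro x s
    rw [prolong_of_ge hH0 _ (by linarith [s.2.1]), add_sub_cancel_left, Set.projIcc_val]
  let c : X → PUnit := fun _ => PUnit.unit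
  let f : Glue p q → AttachCone p :=
    desc (fun y => cyl p c y.1 y.2) (left p c) (fun _ => right p c PUnit.unit) cyl_zero cyl_one
  have hf : Continuous f :=
    continuous_desc continuous_cyl continuous_left continuous_const cyl_zero cyl_one
  have hg1 : ∀ x, prolong p q H x (2 * ((1 : unitInterval) : ℝ)) = right p q b₀ := fun x => by
    refine Eq.trans ?_ ((hEs x 1).trans (congrArg _ (hH1 (q x))))
    norm_num
  let g : AttachCone p → Glue p q :=
    desc (fun y => prolong p q H y.1 (2 * (y.2 : ℝ))) (left p q) (fun _ => right p q b₀)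
      (fun x => by rw [← hE0]; simp) hg1
  have hg : Continuous g :=
    continuous_desc (hEc.comp (f := fun y : X × unitInterval => (y.1, 2 * (y.2 : ℝ)))
      (by fun_prop)) continuous_left continuous_const _ _
  -- From time 1 on the prolonged path lies in `B`, which `f` sends to the apex.
  have hfE : ∀ x r, f (prolong p q H x r) = cyl p c x (Set.projIcc 0 1 zero_le_one r) := by
    intro x r
    rcases le_total r 1 with hr | hr
    · rw [prolong_of_le _ _ hr]; rfl
    · rw [prolong_of_ge hH0 _ hr, Set.projIcc_of_right_le _ hr]; exact (cyl_one x).symm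
  refine ⟨⟨⟨f, hf⟩, ⟨g, hg⟩, ?_, ?_⟩⟩
  -- At stage `s`, `B` is contracted by `H s` and the cylinder is stretched along the prolonged path
  -- up to time `1 + s`. The pieces agree at the end 1 by `hEs`, and `s` going from 0 to 1 leads
  -- from the identity to `g ∘ f`.
  · let K : unitInterval × Glue p q → Glue p q := fun z =>
      desc (fun y => prolong p q H y.1 ((1 + z.1) * y.2)) (left p q)
        (fun b => right p q (H (z.1, b))) (fun x => by rw [← hE0]; simp)
        (fun x => by rw [← hEs]; simp) z.2
    have hK : Continuous K := by
      refine continuous_prod_of ?_ ?_ ?_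
      · exact hEc.comp (f := fun y : unitInterval × (X × unitInterval) =>
          (y.2.1, (1 + (y.1 : ℝ)) * (y.2.2 : ℝ))) (by fun_prop)
      · exact continuous_left.comp continuous_snd
      · exact continuous_right.comp H.continuous
    refine ContinuousMap.Homotopic.symm ⟨⟨⟨K, hK⟩, fun y => ?_, fun y => ?_⟩⟩
    · refine ind (fun x t => ?_) (fun a => rfl) (fun b => congrArg (right p q) (hH0 b)) y
      change prolong p q H x ((1 + ((0 : unitInterval) : ℝ)) * t) = cyl p q x t
      rw [prolong_of_le _ _ (by simpa using t.2.2)]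
      simp
    · refine ind (fun x t => ?_) (fun a => rfl) (fun b => congrArg (right p q) (hH1 b)) y
      change prolong p q H x ((1 + ((1 : unitInterval) : ℝ)) * t) = prolong p q H x (2 * t)
      norm_num
  -- By `hfE`, `f ∘ g` is the reparametrisation `t ↦ min (2t) 1` of the cone coordinate; `min ((1 +
  -- s) t) 1` joins the identity to it.
  · let K : unitInterval × AttachCone p → AttachCone p := fun z =>
      desc (fun y => cyl p c y.1 (Set.projIcc 0 1 zero_le_one ((1 + z.1) * y.2 : ℝ))) (left p c)
        (right p c) (fun x => by rw [← cyl_zero]; simp)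
        (fun x => by
          rw [← cyl_one, Set.projIcc_of_right_le _ (by simpa using z.1.2.1)]; rfl) z.2
    have hK : Continuous K := by
      refine continuous_prod_of ?_ ?_ ?_
      · exact continuous_cyl.comp (f := fun y : unitInterval × (X × unitInterval) =>
          (y.2.1, Set.projIcc 0 1 zero_le_one ((1 + (y.1 : ℝ)) * (y.2.2 : ℝ))))
          ((by fun_prop : Continuous fun y : unitInterval × (X × unitInterval) => y.2.1).prodMk
            (continuous_projIcc.comp (by fun_prop)))
      · exact continuous_left.comp continuous_snd
      · exact continuous_right.comp continuous_snd
    refine ContinuousMap.Homotopic.symm ⟨⟨⟨K, hK⟩, fun y => ?_, fun y => ?_⟩⟩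
    · refine ind (fun x t => ?_) (fun a => rfl) (fun b => rfl) y
      change cyl p c x (Set.projIcc 0 1 zero_le_one ((1 + ((0 : unitInterval) : ℝ)) * t)) =
        cyl p c x t
      simp
    · refine ind (fun x t => ?_) (fun a => rfl) (fun b => rfl) y
      change cyl p c x (Set.projIcc 0 1 zero_le_one ((1 + ((1 : unitInterval) : ℝ)) * t)) =
        f (prolong p q H x (2 * t))
      rw [hfE]
      norm_num

end Glue

/-! ## The decomposition of the Grassmann manifold -/

section Decomposition

variable {n k m : ℕ} {j : Fin (n + 1)}

theorem norm_coordVec : ‖coordVec j‖ = 1 := by simp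

/-- The squared cosine of the angle between a subspace and the `j`-th coordinate line. -/
noncomputable def Gr.height (j : Fin (n + 1)) (L : Gr (n + 1) m) : ℝ :=
  TorusGrassmannian.height (coordVec j) L.proj

theorem Gr.continuous_height : Continuous (Gr.height j : Gr (n + 1) m → ℝ) :=
  (contDiff_height _).continuous.comp Gr.continuous_proj

theorem Gr.height_smul (t : Torus (n + 1)) (L : Gr (n + 1) m) : (t • L).height j = L.height j := by
  rw [Gr.height, Gr.proj_smul,
    height_conjBy (t.unitary_single j) (Circle.norm_coe _), Gr.height]

theorem Gr.height_nonneg (L : Gr (n + 1) m) : 0 ≤ L.height j :=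
  TorusGrassmannian.height_nonneg L.isStarProjection_proj _

theorem Gr.height_le_one (L : Gr (n + 1) m) : L.height j ≤ 1 :=
  TorusGrassmannian.height_le_one L.isStarProjection_proj norm_coordVec

theorem height_inclZero (L : Gr n m) : (inclZero j L).height j = 0 := by
  simp [Gr.height, height, proj_inclZero]

theorem height_inclOne (L : Gr n m) : (inclOne j L).height j = 1 := by
  simp [Gr.height, height, proj_inclOne]

/-- A subspace is generic if it neither contains the `j`-th coordinate line nor is orthogonal
to it. -/
def Gr.IsGeneric (j : Fin (n + 1)) (L : Gr (n + 1) m) : Prop := 0 < L.height j ∧ L.height j < 1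

theorem isFrame_of_isGeneric {L : Gr (n + 1) m} (hL : L.IsGeneric j) :
    IsFrame (coordVec j) (core (coordVec j) L.proj) (direction (coordVec j) L.proj) :=
  isFrame_core_direction L.isStarProjection_proj norm_coordVec hL.1 hL.2

theorem trace_core {L : Gr (n + 1) (k + 1)} (hL : L.IsGeneric j) :
    LinearMap.trace ℂ _ (core (coordVec j) L.proj : CSpace (n + 1) →ₗ[ℂ] CSpace (n + 1)) = k := by
  have h1 := trace_enlarge (isFrame_of_isGeneric hL) (a := √(L.height j)) (b := √(1 - L.height j))
    (by rw [Real.sq_sqrt hL.1.le, Real.sq_sqrt (by linarith [hL.2])]; ring)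
  have h2 := enlarge_core_direction hL.1 hL.2
  rw [Gr.height, h2, Gr.trace_proj] at h1
  push_cast at h1
  exact (add_right_cancel h1).symm

/-- The subspace spanned by the range of the projection `A` and the vector `a e + b u`, where `e` is
the `j`-th coordinate vector. -/
noncomputable def frameGr {A : CSpace (n + 1) →L[ℂ] CSpace (n + 1)} {u : CSpace (n + 1)}
    (h : IsFrame (coordVec j) A u)
    (htr : LinearMap.trace ℂ _ (A : CSpace (n + 1) →ₗ[ℂ] CSpace (n + 1)) = k) {a b : ℝ}
    (hab : a ^ 2 + b ^ 2 = 1) : Gr (n + 1) (k + 1) :=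
  Gr.ofProj (enlarge (coordVec j) A u a b) (h.isStarProjection_enlarge hab)
    (by rw [trace_enlarge h hab, htr]; push_cast; rfl)

/-- A generic subspace, with the part of it that is not orthogonal to the `j`-th coordinate vector
`e` rotated to the line through `a e + b u`. -/
noncomputable def Gr.rotate {L : Gr (n + 1) (k + 1)} (hL : L.IsGeneric j) {a b : ℝ}
    (hab : a ^ 2 + b ^ 2 = 1) : Gr (n + 1) (k + 1) :=
  frameGr (isFrame_of_isGeneric hL) (trace_core hL) hab

theorem Gr.proj_rotate {L : Gr (n + 1) (k + 1)} (hL : L.IsGeneric j) {a b : ℝ}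
    (hab : a ^ 2 + b ^ 2 = 1) :
    (Gr.rotate hL hab).proj = TorusGrassmannian.rotate (coordVec j) L.proj a b := by
  rw [Gr.rotate, frameGr, Gr.proj_ofProj]
  rfl

theorem Gr.height_rotate {L : Gr (n + 1) (k + 1)} (hL : L.IsGeneric j) {a b : ℝ}
    (hab : a ^ 2 + b ^ 2 = 1) : (Gr.rotate hL hab).height j = a ^ 2 := by
  rw [Gr.height, Gr.proj_rotate, TorusGrassmannian.rotate,
    (isFrame_of_isGeneric hL).height_enlarge]

theorem core_rotate {L : Gr (n + 1) (k + 1)} (hL : L.IsGeneric j) {a : ℝ} (b : ℝ) (ha : 0 < a) :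
    core (coordVec j) (rotate (coordVec j) L.proj a b) = core (coordVec j) L.proj :=
  (isFrame_of_isGeneric hL).core_enlarge b ha.ne'

/-- Rotation to a line with positive coefficients keeps the frame, so a second rotation forgets the
first. This makes `Gr.toMiddle` and `cylPoint` inverse to each other. -/
theorem rotate_rotate {L : Gr (n + 1) (k + 1)} (hL : L.IsGeneric j) {a b : ℝ}
    (hab : a ^ 2 + b ^ 2 = 1) (ha : 0 < a) (hb : 0 < b) (c d : ℝ) :
    rotate (coordVec j) (rotate (coordVec j) L.proj a b) c d = rotate (coordVec j) L.proj c d := by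
  rw [rotate, core_rotate hL b ha]
  conv_lhs => rw [rotate, (isFrame_of_isGeneric hL).direction_enlarge hab ha hb]
  rfl

theorem rotate_self {L : Gr (n + 1) m} (hL : L.IsGeneric j) :
    rotate (coordVec j) L.proj (√(L.height j)) (√(1 - L.height j)) = L.proj :=
  enlarge_core_direction hL.1 hL.2

theorem core_apply_coordVec {L : Gr (n + 1) m} (hL : L.IsGeneric j) :
    core (coordVec j) L.proj (coordVec j) = 0 :=
  (isFrame_of_isGeneric hL).map_e

/-- The part of a generic subspace that is orthogonal to the `j`-th coordinate vector. -/
noncomputable def Gr.section {L : Gr (n + 1) (k + 1)} (hL : L.IsGeneric j) : Gr n k :=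
  Gr.ofProj (compressOp j (core (coordVec j) L.proj))
    (isStarProjection_compressOp (isFrame_of_isGeneric hL).proj (core_apply_coordVec hL))
    (by rw [trace_compressOp (isFrame_of_isGeneric hL).proj (core_apply_coordVec hL),
      trace_core hL])

theorem inclOne_section {L : Gr (n + 1) (k + 1)} (hL : L.IsGeneric j) :
    inclOne j (Gr.section hL) = Gr.rotate hL (a := 1) (b := 0) (by norm_num) := by
  apply Gr.proj_injective
  rw [proj_inclOne, Gr.proj_rotate, Gr.section, Gr.proj_ofProj,
    embedOp_compressOp (isFrame_of_isGeneric hL).proj (core_apply_coordVec hL), rotate, enlarge]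
  simp

/-- A subspace that is orthogonal to the `j`-th coordinate vector, as a subspace of `ℂⁿ`. -/
noncomputable def Gr.compress (L : Gr (n + 1) m) (hL : L.height j = 0) : Gr n m :=
  Gr.ofProj (compressOp j L.proj)
    (isStarProjection_compressOp L.isStarProjection_proj
      (apply_eq_zero_of_height L.isStarProjection_proj hL))
    (by rw [trace_compressOp L.isStarProjection_proj
      (apply_eq_zero_of_height L.isStarProjection_proj hL), L.trace_proj])

theorem inclZero_compress (L : Gr (n + 1) m) (hL : L.height j = 0) :
    inclZero j (L.compress hL) = L := by
  apply Gr.proj_injective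
  rw [proj_inclZero, Gr.compress, Gr.proj_ofProj,
    embedOp_compressOp L.isStarProjection_proj (apply_eq_zero_of_height L.isStarProjection_proj hL)]

theorem exists_inclOne_eq (L : Gr (n + 1) (k + 1)) (hL : L.height j = 1) :
    ∃ M : Gr n k, inclOne j M = L := by
  have h1 := apply_eq_self_of_height L.isStarProjection_proj norm_coordVec hL
  have h2 := isStarProjection_sub_lineProj L.isStarProjection_proj h1 norm_coordVec
  have h3 : (L.proj - lineProj (coordVec j)) (coordVec j) = 0 := by simp [h1]
  refine ⟨Gr.ofProj _ (isStarProjection_compressOp h2 h3) ?_, Gr.proj_injective ?_⟩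
  · rw [trace_compressOp h2 h3, ContinuousLinearMap.toLinearMap_sub, map_sub, trace_rankOne,
      L.trace_proj]
    simp
  · rw [proj_inclOne, Gr.proj_ofProj, embedOp_compressOp h2 h3, sub_add_cancel]

theorem mem_ranges_iff (L : Gr (n + 1) (k + 1)) :
    L ∈ (Set.range (inclZero (k := k + 1) j) ∪ Set.range (inclOne (k := k) j))ᶜ ↔
      L.IsGeneric j := by
  constructor
  · intro h
    refine ⟨L.height_nonneg.lt_of_ne' fun h0 => h (.inl ⟨_, inclZero_compress L h0⟩),
      L.height_le_one.lt_of_ne fun h1 => h (.inr (exists_inclOne_eq L h1))⟩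
  · rintro h (⟨M, rfl⟩ | ⟨M, rfl⟩)
    · exact h.1.ne' (height_inclZero M)
    · exact h.2.ne (height_inclOne M)

/-! ### The hypersurface -/

variable (n k j) in
/-- The subspaces which have the angle `π / 4` with the `j`-th coordinate line. -/
def middleLevel : SubMulAction (Torus (n + 1)) (Gr (n + 1) (k + 1)) where
  carrier := {L | L.height j = 1 / 2}
  smul_mem' t L hL := (Gr.height_smul t L).trans hL

theorem isGeneric_of_mem {L : Gr (n + 1) (k + 1)} (h : L ∈ middleLevel n k j) : L.IsGeneric j := by
  have h' : L.height j = 1 / 2 := h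
  constructor <;> rw [h'] <;> norm_num

theorem isClosed_middleLevel : IsClosed (middleLevel n k j : Set (Gr (n + 1) (k + 1))) :=
  isClosed_eq Gr.continuous_height continuous_const

/-- The level function is `height - 1/2`, and the transversal curve rotates the line within the
frame of `L`, through the angle `π / 4` at time 0. -/
theorem isSmoothHypersurface_middleLevel :
    IsSmoothHypersurface (middleLevel n k j : Set (Gr (n + 1) (k + 1))) := by
  intro L hL
  have hg := isGeneric_of_mem hL
  have hh : L.height j = 1 / 2 := hL
  have hab : ∀ θ : ℝ, Real.cos θ ^ 2 + Real.sin θ ^ 2 = 1 := Real.cos_sq_add_sin_sq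
  refine ⟨Set.univ, fun P => height (coordVec j) P - 1 / 2, isOpen_univ, trivial,
    ((contDiff_height _).sub contDiff_const).contDiffOn, fun M _ => sub_eq_zero.symm,
    fun θ => Gr.rotate hg (hab (Real.pi / 4 + θ)), ?_, ?_, ?_⟩
  · apply Gr.proj_injective
    have h1 : √(1 / 2) = √2 / 2 := by
      rw [Real.sqrt_eq_iff_mul_self_eq (by norm_num) (by positivity)]
      nlinarith [Real.sq_sqrt (zero_le_two (α := ℝ))]
    have h2 := rotate_self hg
    rw [hh, show (1 : ℝ) - 1 / 2 = 1 / 2 by norm_num, h1] at h2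
    rw [Gr.proj_rotate, add_zero, Real.cos_pi_div_four, Real.sin_pi_div_four, h2]
  · simp only [Gr.proj_rotate]
    exact contDiffAt_rotate contDiffAt_const
      (Real.contDiff_cos.contDiffAt.comp _ (contDiffAt_const.add contDiffAt_id))
      (Real.contDiff_sin.contDiffAt.comp _ (contDiffAt_const.add contDiffAt_id)) hg.1 hg.2
  · have h1 : ∀ θ : ℝ, height (coordVec j) (Gr.rotate hg (hab (Real.pi / 4 + θ))).proj - 1 / 2 =
        Real.cos (Real.pi / 4 + θ) ^ 2 - 1 / 2 := fun θ => by
      rw [← Gr.height_rotate hg (hab (Real.pi / 4 + θ)), Gr.height]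
    change deriv (fun θ : ℝ => height (coordVec j)
      (Gr.rotate hg (hab (Real.pi / 4 + θ))).proj - 1 / 2) 0 ≠ 0
    rw [funext h1]
    -- The derivative of `cos²` is `-2 cos sin`, which is `-1` at `π / 4`.
    have h2 : HasDerivAt (fun θ : ℝ => Real.cos (Real.pi / 4 + θ) ^ 2 - 1 / 2) (-1) 0 := by
      have := ((((hasDerivAt_id (0 : ℝ)).const_add (Real.pi / 4)).cos).pow 2).sub_const (1 / 2)
      refine HasDerivAt.congr_deriv this ?_
      simp only [id, add_zero, Real.cos_pi_div_four, Real.sin_pi_div_four]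
      norm_num
      nlinarith [Real.sq_sqrt (zero_le_two (α := ℝ))]
    rw [h2.deriv]
    norm_num

/-! ### The projections and the cylinder coordinates -/

theorem sqrt_sq_add_sqrt_sq (t : unitInterval) : √(t : ℝ) ^ 2 + √(1 - t : ℝ) ^ 2 = 1 := by
  rw [Real.sq_sqrt t.2.1, Real.sq_sqrt (by linarith [t.2.2])]; ring

/-- The point with parameter `t` on the path through a point of the hypersurface. -/
noncomputable def cylPoint (s : middleLevel n k j) (t : unitInterval) : Gr (n + 1) (k + 1) :=
  Gr.rotate (isGeneric_of_mem s.2) (sqrt_sq_add_sqrt_sq t)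

theorem proj_cylPoint (s : middleLevel n k j) (t : unitInterval) :
    (cylPoint s t).proj = rotate (coordVec j) s.1.proj √(t : ℝ) √(1 - t : ℝ) :=
  Gr.proj_rotate _ _

theorem height_cylPoint (s : middleLevel n k j) (t : unitInterval) :
    (cylPoint s t).height j = t := by
  rw [cylPoint, Gr.height_rotate, Real.sq_sqrt t.2.1]

theorem cylPoint_middle (s : middleLevel n k j) : cylPoint s middle = s.1 := by
  have h := rotate_self (isGeneric_of_mem s.2)
  rw [show s.1.height j = 1 / 2 from s.2] at h
  exact Gr.proj_injective ((proj_cylPoint _ _).trans h)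

theorem cylPoint_smul (g : Torus (n + 1)) (s : middleLevel n k j) (t : unitInterval) :
    cylPoint (g • s) t = g • cylPoint s t := by
  apply Gr.proj_injective
  rw [proj_cylPoint, Gr.proj_smul, proj_cylPoint,
    ← rotate_conjBy (g.unitary_single j) (Circle.norm_coe _), ← Gr.proj_smul]
  rfl

theorem continuous_cylPoint :
    Continuous (fun y : middleLevel n k j × unitInterval => cylPoint y.1 y.2) := by
  rw [Gr.isEmbedding_proj.continuous_iff, continuous_iff_continuousAt]
  intro y
  have hg := isGeneric_of_mem y.1.2
  let w : (CSpace (n + 1) →L[ℂ] CSpace (n + 1)) × ℝ × ℝ := (y.1.1.proj, √(y.2 : ℝ), √(1 - y.2 : ℝ))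
  have h1 : ContinuousAt (fun w : (CSpace (n + 1) →L[ℂ] CSpace (n + 1)) × ℝ × ℝ =>
      rotate (coordVec j) w.1 w.2.1 w.2.2) w :=
    (contDiffAt_rotate contDiffAt_fst (contDiffAt_fst.comp w contDiffAt_snd)
      (contDiffAt_snd.comp w contDiffAt_snd) hg.1 hg.2).continuousAt
  have h2 : Continuous (fun y : middleLevel n k j × unitInterval =>
      (y.1.1.proj, √(y.2 : ℝ), √(1 - y.2 : ℝ))) :=
    (Gr.continuous_proj.comp (by fun_prop)).prodMk (by fun_prop)
  have h3 := ContinuousAt.comp (f := fun y : middleLevel n k j × unitInterval =>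
      (y.1.1.proj, √(y.2 : ℝ), √(1 - y.2 : ℝ))) (x := y) h1 h2.continuousAt
  exact h3.congr (.of_forall fun z => (proj_cylPoint z.1 z.2).symm)

/-- The projection of the hypersurface to `G_{n,k+1}`. -/
noncomputable def projZero (s : middleLevel n k j) : Gr n (k + 1) :=
  (cylPoint s 0).compress (by rw [height_cylPoint]; rfl)

/-- The projection of the hypersurface to `G_{n,k}`. -/
noncomputable def projOne (s : middleLevel n k j) : Gr n k := Gr.section (isGeneric_of_mem s.2)

theorem inclZero_projZero (s : middleLevel n k j) : inclZero j (projZero s) = cylPoint s 0 :=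
  inclZero_compress _ _

theorem inclOne_projOne (s : middleLevel n k j) : inclOne j (projOne s) = cylPoint s 1 := by
  apply Gr.proj_injective
  rw [projOne, inclOne_section, Gr.proj_rotate, proj_cylPoint]
  simp

theorem projZero_smul (t : Torus (n + 1)) (s : middleLevel n k j) :
    projZero (t • s) = t.drop j • projZero s := by
  apply inclZero_injective (j := j)
  rw [inclZero_projZero, inclZero_smul, inclZero_projZero, cylPoint_smul]

theorem projOne_smul (t : Torus (n + 1)) (s : middleLevel n k j) :
    projOne (t • s) = t.drop j • projOne s := by
  apply inclOne_injective (j := j)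
  rw [inclOne_projOne, inclOne_smul, inclOne_projOne, cylPoint_smul]

/-- The condition is imposed on all operators, not only on projections: this is the ambient open set
to which the formulas for the projections and the cylinder coordinates extend smoothly. -/
theorem isOpen_generic {m : ℕ} (e : CSpace m) :
    IsOpen {P : CSpace m →L[ℂ] CSpace m | 0 < height e P ∧ height e P < 1} :=
  (isOpen_lt continuous_const (contDiff_height e).continuous).inter
    (isOpen_lt (contDiff_height e).continuous continuous_const)

theorem isSmoothMap_projZero : IsSmoothMap (fun s : middleLevel n k j => s.1.proj) Gr.proj
    (projZero : middleLevel n k j → Gr n (k + 1)) := by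
  intro s
  refine ⟨_, fun P => compressOp j (rotate (coordVec j) P 0 1), isOpen_generic (coordVec j),
    isGeneric_of_mem s.2, fun P hP => ?_, fun y _ => ?_⟩
  · exact ((contDiff_compressOp j).contDiffAt.comp P
      (contDiffAt_rotate contDiffAt_id contDiffAt_const contDiffAt_const
        hP.1 hP.2)).contDiffWithinAt
  · rw [projZero, Gr.compress, Gr.proj_ofProj, proj_cylPoint]
    simp

theorem isSmoothMap_projOne : IsSmoothMap (fun s : middleLevel n k j => s.1.proj) Gr.proj
    (projOne : middleLevel n k j → Gr n k) := by
  intro s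
  refine ⟨_, fun P => compressOp j (core (coordVec j) P), isOpen_generic (coordVec j),
    isGeneric_of_mem s.2, fun P hP => ?_, fun y _ => ?_⟩
  · exact ((contDiff_compressOp j).contDiffAt.comp P (contDiffAt_core hP.1)).contDiffWithinAt
  · rw [projOne, Gr.section, Gr.proj_ofProj]

theorem continuous_inclZero : Continuous (inclZero j : Gr n m → Gr (n + 1) m) := by
  rw [Gr.isEmbedding_proj.continuous_iff]
  exact ((continuous_embedOp j).comp Gr.continuous_proj).congr fun L => (proj_inclZero L).symm

theorem continuous_inclOne : Continuous (inclOne j : Gr n m → Gr (n + 1) (m + 1)) := by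
  rw [Gr.isEmbedding_proj.continuous_iff]
  exact (((continuous_embedOp j).comp Gr.continuous_proj).add continuous_const).congr
    fun L => (proj_inclOne L).symm

theorem sq_sqrt_half_add : √(1 / 2 : ℝ) ^ 2 + √(1 / 2 : ℝ) ^ 2 = 1 := by
  rw [Real.sq_sqrt (by norm_num)]; norm_num

/-- The point of the hypersurface on the path through a generic subspace. -/
noncomputable def Gr.toMiddle {L : Gr (n + 1) (k + 1)} (hL : L.IsGeneric j) : middleLevel n k j :=
  ⟨Gr.rotate hL sq_sqrt_half_add, by
    change Gr.height j _ = 1 / 2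
    rw [Gr.height_rotate, Real.sq_sqrt (by norm_num)]⟩

theorem cylPoint_toMiddle {L : Gr (n + 1) (k + 1)} (hL : L.IsGeneric j) {t : unitInterval}
    (ht : (t : ℝ) = L.height j) : cylPoint (Gr.toMiddle hL) t = L := by
  apply Gr.proj_injective
  rw [proj_cylPoint, ht, Gr.toMiddle, Gr.proj_rotate,
    rotate_rotate hL sq_sqrt_half_add (by positivity) (by positivity), rotate_self hL]

theorem isGeneric_cylPoint (s : middleLevel n k j) {t : unitInterval} (h0 : 0 < (t : ℝ))
    (h1 : (t : ℝ) < 1) : (cylPoint s t).IsGeneric j := by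
  rw [Gr.IsGeneric, height_cylPoint]
  exact ⟨h0, h1⟩

theorem toMiddle_cylPoint (s : middleLevel n k j) {t : unitInterval} (h0 : 0 < (t : ℝ))
    (h1 : (t : ℝ) < 1) : Gr.toMiddle (isGeneric_cylPoint s h0 h1) = s := by
  apply Subtype.ext
  apply Gr.proj_injective
  have h := rotate_self (isGeneric_of_mem s.2)
  rw [show s.1.height j = 1 / 2 from s.2, show (1 : ℝ) - 1 / 2 = 1 / 2 by norm_num] at h
  rw [Gr.toMiddle, Gr.proj_rotate, proj_cylPoint, rotate_rotate (isGeneric_of_mem s.2)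
    (sqrt_sq_add_sqrt_sq t) (Real.sqrt_pos.2 h0) (Real.sqrt_pos.2 (by linarith)), h]

/-! ### Surjectivity of the projections -/

/-- Every frame with `A` of rank `k` comes from a point of the hypersurface, namely `A` plus the
line through `e + u`. Surjectivity of both projections is thereby reduced to choosing a frame. -/
theorem exists_mem_middleLevel_of_frame {A : CSpace (n + 1) →L[ℂ] CSpace (n + 1)}
    {u : CSpace (n + 1)} (h : IsFrame (coordVec j) A u)
    (htr : LinearMap.trace ℂ _ (A : CSpace (n + 1) →ₗ[ℂ] CSpace (n + 1)) = k) :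
    ∃ s : middleLevel n k j, ∀ t : unitInterval,
      (cylPoint s t).proj = enlarge (coordVec j) A u √(t : ℝ) √(1 - t : ℝ) := by
  have hp : (frameGr h htr sq_sqrt_half_add).proj =
      enlarge (coordVec j) A u √(1 / 2) √(1 / 2) := Gr.proj_ofProj _ _ _
  have hs : 0 < √(1 / 2 : ℝ) := by positivity
  refine ⟨⟨frameGr h htr sq_sqrt_half_add, ?_⟩, fun t => ?_⟩
  · change Gr.height j _ = 1 / 2
    rw [Gr.height, hp, h.height_enlarge, Real.sq_sqrt (by norm_num)]
  · rw [proj_cylPoint, hp, rotate, h.core_enlarge _ hs.ne',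
      h.direction_enlarge sq_sqrt_half_add hs hs]

theorem exists_unit_mem {K : Submodule ℂ (CSpace n)} (hK : K ≠ ⊥) : ∃ v ∈ K, ‖v‖ = 1 := by
  obtain ⟨v, hv, hv0⟩ := K.exists_mem_ne_zero_of_ne_bot hK
  refine ⟨((‖v‖⁻¹ : ℝ) : ℂ) • v, K.smul_mem _ hv, ?_⟩
  rw [norm_smul, Complex.norm_real, norm_inv, norm_norm, inv_mul_cancel₀ (norm_ne_zero_iff.2 hv0)]

theorem Gr.proj_apply_of_mem {L : Gr n m} {v : CSpace n} (hv : v ∈ L.1) : L.proj v = v :=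
  Submodule.starProjection_eq_self_iff.2 hv

theorem projZero_surjective :
    Function.Surjective (projZero : middleLevel n k j → Gr n (k + 1)) := by
  intro L
  obtain ⟨v, hv, hv1⟩ := exists_unit_mem (K := L.1) (fun h => by
    have := L.2
    rw [h, finrank_bot] at this
    omega)
  have hu : ‖coordL j v‖ = 1 := by rw [norm_coordL, hv1]
  have hA : embedOp j L.proj (coordL j v) = coordL j v := by
    rw [embedOp_apply, coordDrop_coordL, Gr.proj_apply_of_mem hv]
  have hE := isStarProjection_embedOp (j := j) L.isStarProjection_proj
  have huu : inner ℂ (coordL j v) (coordL j v) = (1 : ℂ) := by rw [inner_self_eq_ofReal, hu]; simp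
  -- To hit `L` at the end 0, split off a unit vector `v` of `L` as the direction; the complement of
  -- `v` in `L` is the core.
  have h : IsFrame (coordVec j) (embedOp j L.proj - lineProj (coordL j v)) (coordL j v) :=
    ⟨norm_coordVec, isStarProjection_sub_lineProj hE hA hu, by simp [inner_coordL],
      by rw [sub_apply, hA, rankOne_apply, huu, one_smul, sub_self], hu, by simp⟩
  obtain ⟨s, hs⟩ := exists_mem_middleLevel_of_frame (k := k) h (by
    rw [ContinuousLinearMap.toLinearMap_sub, map_sub, trace_embedOp, trace_rankOne, L.trace_proj,
      huu]
    simp)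
  refine ⟨s, inclZero_injective (j := j) (Gr.proj_injective ?_)⟩
  rw [inclZero_projZero, hs, proj_inclZero, enlarge]
  simp

theorem projOne_surjective (hk : k < n) :
    Function.Surjective (projOne : middleLevel n k j → Gr n k) := by
  intro L
  obtain ⟨v, hv, hv1⟩ := exists_unit_mem (K := L.1ᗮ) (fun h => by
    have h1 := L.1.finrank_add_finrank_orthogonal
    rw [h, finrank_bot, L.2, finrank_euclideanSpace_fin] at h1
    omega)
  have hu : ‖coordL j v‖ = 1 := by rw [norm_coordL, hv1]
  have hP : L.proj v = 0 := (Submodule.starProjection_apply_eq_zero_iff _).2 hv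
  -- To hit `L` at the end 1, take `L` itself as the core and any unit vector of its orthogonal
  -- complement, which is nonzero because `k < n`, as the direction.
  have h : IsFrame (coordVec j) (embedOp j L.proj) (coordL j v) :=
    ⟨norm_coordVec, isStarProjection_embedOp L.isStarProjection_proj, by simp,
      by rw [embedOp_apply, coordDrop_coordL, hP, map_zero], hu, by simp⟩
  obtain ⟨s, hs⟩ := exists_mem_middleLevel_of_frame (k := k) h
    (by rw [trace_embedOp, L.trace_proj])
  refine ⟨s, inclOne_injective (j := j) (Gr.proj_injective ?_)⟩
  rw [inclOne_projOne, hs, proj_inclOne, enlarge]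
  simp

/-! ### The homeomorphism -/

instance : CompactSpace (middleLevel n k j) :=
  isCompact_iff_compactSpace.1 (isClosed_middleLevel (n := n) (k := k) (j := j)).isCompact

/-- The map from the glued space to the Grassmann manifold. -/
noncomputable def glueMap :
    Glue (projZero : middleLevel n k j → _) projOne → Gr (n + 1) (k + 1) :=
  Glue.desc (fun y => cylPoint y.1 y.2) (inclZero j) (inclOne j)
    (fun s => (inclZero_projZero s).symm) (fun s => (inclOne_projOne s).symm)

theorem continuous_glueMap : Continuous (glueMap (n := n) (k := k) (j := j)) :=
  Glue.continuous_desc continuous_cylPoint continuous_inclZero continuous_inclOne _ _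

/-- The height separates the two ends from each other and from the interior, and gives the cylinder
parameter; `Gr.toMiddle` then recovers the point of the hypersurface. -/
theorem glueMap_injective : Function.Injective (glueMap (n := n) (k := k) (j := j)) := by
  have hc : ∀ (s : middleLevel n k j) t, (glueMap (Glue.cyl _ _ s t)).height j = t :=
    height_cylPoint
  have hl : ∀ a, (glueMap (n := n) (k := k) (j := j) (Glue.left _ _ a)).height j = 0 :=
    height_inclZero
  have hr : ∀ b, (glueMap (n := n) (k := k) (j := j) (Glue.right _ _ b)).height j = 1 :=
    height_inclOne
  intro y z
  refine Glue.ind_interior (motive := fun y => glueMap y = glueMap z → y = z)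
      (fun s t h0 h1 => ?_) (fun a => ?_) (fun b => ?_) y <;>
    refine Glue.ind_interior (motive := fun z => glueMap _ = glueMap z → _ = z)
      (fun s' t' h0' h1' => ?_) (fun a' => ?_) (fun b' => ?_) z <;>
    intro h <;> have hh := congrArg (Gr.height j) h <;> simp only [hc, hl, hr] at hh
  · obtain rfl : t = t' := Subtype.ext hh
    have h2 : cylPoint s t = cylPoint s' t := h
    have h3 : ∀ L M (hL : Gr.IsGeneric j L) (hM : Gr.IsGeneric j M), L = M →
        Gr.toMiddle hL = (Gr.toMiddle hM : middleLevel n k j) := by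
      rintro L _ _ _ rfl; rfl
    have h4 := h3 _ _ (isGeneric_cylPoint s h0 h1) (isGeneric_cylPoint s' h0 h1) h2
    rw [toMiddle_cylPoint s h0 h1, toMiddle_cylPoint s' h0 h1] at h4
    rw [h4]
  · exact absurd hh h0.ne'
  · exact absurd hh h1.ne
  · exact absurd hh h0'.ne
  · exact congrArg _ (inclZero_injective h)
  · exact absurd hh zero_ne_one
  · exact absurd hh h1'.ne'
  · exact absurd hh one_ne_zero
  · exact congrArg _ (inclOne_injective h)

theorem glueMap_surjective : Function.Surjective (glueMap (n := n) (k := k) (j := j)) := by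
  intro L
  by_cases hL : L.IsGeneric j
  · exact ⟨Glue.cyl _ _ (Gr.toMiddle hL) ⟨L.height j, hL.1.le, hL.2.le⟩, cylPoint_toMiddle hL rfl⟩
  · rw [← mem_ranges_iff, Set.notMem_compl_iff] at hL
    rcases hL with ⟨M, rfl⟩ | ⟨M, rfl⟩
    exacts [⟨Glue.left _ _ M, rfl⟩, ⟨Glue.right _ _ M, rfl⟩]

/-- The homeomorphism between the glued space and the Grassmann manifold. -/
noncomputable def glueHomeo :
    Glue (projZero : middleLevel n k j → _) projOne ≃ₜ Gr (n + 1) (k + 1) :=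
  Continuous.homeoOfEquivCompactToT2
    (f := Equiv.ofBijective glueMap ⟨glueMap_injective, glueMap_surjective⟩) continuous_glueMap

theorem continuous_projZero : Continuous (projZero : middleLevel n k j → _) := by
  rw [(continuous_inclZero.isClosedEmbedding (inclZero_injective (j := j))).continuous_iff]
  exact (continuous_cylPoint.comp (continuous_id.prodMk (continuous_const (y := 0)))).congr
    fun s => (inclZero_projZero s).symm

theorem continuous_projOne : Continuous (projOne : middleLevel n k j → _) := by
  rw [(continuous_inclOne.isClosedEmbedding (inclOne_injective (j := j))).continuous_iff]
  exact (continuous_cylPoint.comp (continuous_id.prodMk (continuous_const (y := 1)))).congr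
    fun s => (inclOne_projOne s).symm

/-- The cylinder coordinates on the generic subspaces. -/
noncomputable def genericEquiv : middleLevel n k j × Set.Ioo (0 : ℝ) 1 ≃
    ((Set.range (inclZero (k := k + 1) j) ∪ Set.range (inclOne (k := k) j))ᶜ :
      Set (Gr (n + 1) (k + 1))) where
  toFun y := ⟨cylPoint y.1 (openToUnit y.2),
    (mem_ranges_iff _).2 (isGeneric_cylPoint _ y.2.2.1 y.2.2.2)⟩
  invFun L := (Gr.toMiddle ((mem_ranges_iff _).1 L.2),
    ⟨L.1.height j, ((mem_ranges_iff _).1 L.2).1, ((mem_ranges_iff _).1 L.2).2⟩)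
  left_inv y := Prod.ext (toMiddle_cylPoint y.1 y.2.2.1 y.2.2.2)
    (Subtype.ext (height_cylPoint y.1 (openToUnit y.2)))
  right_inv _ := Subtype.ext (cylPoint_toMiddle _ rfl)

theorem isSmoothMap_genericEquiv :
    IsSmoothMap (fun y : middleLevel n k j × Set.Ioo (0 : ℝ) 1 => (y.1.1.proj, (y.2 : ℝ)))
      (fun L => L.1.proj) (genericEquiv (n := n) (k := k) (j := j)) := by
  intro y
  refine ⟨{P | 0 < height (coordVec j) P ∧ height (coordVec j) P < 1} ×ˢ Set.Ioo 0 1,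
    fun w => rotate (coordVec j) w.1 √w.2 √(1 - w.2), (isOpen_generic _).prod isOpen_Ioo,
    ⟨isGeneric_of_mem y.1.2, y.2.2⟩, fun w hw => ContDiffAt.contDiffWithinAt ?_,
    fun z _ => proj_cylPoint z.1 (openToUnit z.2)⟩
  exact contDiffAt_rotate contDiffAt_fst (contDiffAt_snd.sqrt hw.2.1.ne')
    ((contDiffAt_const.sub contDiffAt_snd).sqrt (sub_pos.2 hw.2.2).ne') hw.1.1 hw.1.2

theorem isSmoothMap_genericEquiv_symm :
    IsSmoothMap (fun L => L.1.proj)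
      (fun y : middleLevel n k j × Set.Ioo (0 : ℝ) 1 => (y.1.1.proj, (y.2 : ℝ)))
      (genericEquiv (n := n) (k := k) (j := j)).symm := by
  intro L
  refine ⟨_, fun P => (rotate (coordVec j) P √(1 / 2) √(1 / 2), height (coordVec j) P),
    isOpen_generic (coordVec j), (mem_ranges_iff _).1 L.2,
    fun P hP => ContDiffAt.contDiffWithinAt ?_,
    fun M _ => Prod.ext (Gr.proj_rotate ((mem_ranges_iff _).1 M.2) sq_sqrt_half_add) rfl⟩
  exact (contDiffAt_rotate contDiffAt_id contDiffAt_const contDiffAt_const hP.1 hP.2).prodMk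
    (contDiff_height _).contDiffAt

end Decomposition

/-! ## Orbit spaces -/

section Orbits

variable {T T' X A B Z : Type*} [Group T] [Group T'] [MulAction T X] [MulAction T' A]
  [MulAction T' B] [MulAction T Z]

theorem orb_smul (t : T) (x : X) : orb T (t • x) = orb T x :=
  Quotient.sound ⟨t, rfl⟩

/-- The map of orbit spaces that is induced by an equivariant map. -/
def orbMap (θ : T → T') (p : X → A) (hp : ∀ t x, p (t • x) = θ t • p x) :
    OrbitSpace T X → OrbitSpace T' A :=
  Quotient.lift (fun x => orb T' (p x)) (by
    rintro _ x ⟨t, rfl⟩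
    change orb T' (p (t • x)) = _
    rw [hp, orb_smul])

variable [TopologicalSpace X] [TopologicalSpace A] [TopologicalSpace B] [TopologicalSpace Z]

theorem continuous_orb : Continuous (orb T : X → OrbitSpace T X) := continuous_quot_mk

theorem continuous_orbMap {θ : T → T'} {p : X → A} (hp : ∀ t x, p (t • x) = θ t • p x)
    (hc : Continuous p) : Continuous (orbMap θ p hp) :=
  (continuous_orb.comp hc).quotient_lift _

/-- An equivariant homeomorphism from a glued space induces a homeomorphism from the space that is
glued from the orbit spaces. -/
theorem exists_orbit_homeomorph [ContinuousConstSMul T X] {θ : T → T'}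
    (hθ : Function.Surjective θ) {p : X → A} {q : X → B}
    (hp : ∀ t x, p (t • x) = θ t • p x) (hq : ∀ t x, q (t • x) = θ t • q x)
    (Φ : Glue p q ≃ₜ Z)
    (hc : ∀ (t : T) x r, Φ (Glue.cyl p q (t • x) r) = t • Φ (Glue.cyl p q x r))
    (hl : ∀ (t : T) a, Φ (Glue.left p q (θ t • a)) = t • Φ (Glue.left p q a))
    (hr : ∀ (t : T) b, Φ (Glue.right p q (θ t • b)) = t • Φ (Glue.right p q b)) :
    ∃ φ : Glue (orbMap θ p hp) (orbMap θ q hq) ≃ₜ OrbitSpace T Z,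
      (∀ x r, φ (Glue.cyl _ _ (orb T x) r) = orb T (Φ (Glue.cyl p q x r))) ∧
      (∀ a, φ (Glue.left _ _ (orb T' a)) = orb T (Φ (Glue.left p q a))) ∧
      (∀ b, φ (Glue.right _ _ (orb T' b)) = orb T (Φ (Glue.right p q b))) := by
  let f : OrbitSpace T X × unitInterval → OrbitSpace T Z := fun y =>
    Quotient.lift (fun x => orb T (Φ (Glue.cyl p q x y.2))) (by
      rintro _ x ⟨t, rfl⟩
      change orb T (Φ (Glue.cyl p q (t • x) y.2)) = _
      rw [hc, orb_smul]) y.1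
  have hf : Continuous f := by
    -- Orbit maps are open, so the product with the interval is still a quotient map.
    have hQ : IsOpenQuotientMap (Prod.map (Quotient.mk (MulAction.orbitRel T X)) id :
        X × unitInterval → _) :=
      MulAction.isOpenQuotientMap_quotientMk.prodMap IsOpenQuotientMap.id
    rw [hQ.isQuotientMap.continuous_iff]
    exact continuous_orb.comp (Φ.continuous.comp Glue.continuous_cyl)
  let g : OrbitSpace T' A → OrbitSpace T Z :=
    Quotient.lift (fun a => orb T (Φ (Glue.left p q a))) (by
      rintro _ a ⟨t', rfl⟩
      obtain ⟨t, rfl⟩ := hθ t'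
      change orb T (Φ (Glue.left p q (θ t • a))) = _
      rw [hl, orb_smul])
  have hg : Continuous g :=
    (continuous_orb.comp (Φ.continuous.comp Glue.continuous_left)).quotient_lift _
  let h : OrbitSpace T' B → OrbitSpace T Z :=
    Quotient.lift (fun b => orb T (Φ (Glue.right p q b))) (by
      rintro _ b ⟨t', rfl⟩
      obtain ⟨t, rfl⟩ := hθ t'
      change orb T (Φ (Glue.right p q (θ t • b))) = _
      rw [hr, orb_smul])
  have hh : Continuous h :=
    (continuous_orb.comp (Φ.continuous.comp Glue.continuous_right)).quotient_lift _
  have h0 : ∀ y, f (y, 0) = g (orbMap θ p hp y) := by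
    rintro ⟨x⟩
    exact congrArg (fun z => orb T (Φ z)) (Glue.cyl_zero x)
  have h1 : ∀ y, f (y, 1) = h (orbMap θ q hq y) := by
    rintro ⟨x⟩
    exact congrArg (fun z => orb T (Φ z)) (Glue.cyl_one x)
  let G : Glue p q → Glue (orbMap θ p hp) (orbMap θ q hq) :=
    Glue.desc (fun y => Glue.cyl _ _ (orb T y.1) y.2) (fun a => Glue.left _ _ (orb T' a))
      (fun b => Glue.right _ _ (orb T' b)) (fun x => Glue.cyl_zero _) (fun x => Glue.cyl_one _)
  have hG : Continuous G := Glue.continuous_desc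
    (Glue.continuous_cyl.comp ((continuous_orb.comp continuous_fst).prodMk continuous_snd))
    (Glue.continuous_left.comp continuous_orb) (Glue.continuous_right.comp continuous_orb) _ _
  -- `G` is invariant under the action transported along `Φ`, so `G ∘ Φ.symm` descends to orbits and
  -- gives the inverse.
  have hinv : ∀ (t : T) y, G (Φ.symm (t • Φ y)) = G y := by
    intro t y
    refine Glue.ind (fun x r => ?_) (fun a => ?_) (fun b => ?_) y
    · rw [← hc, Φ.symm_apply_apply]
      exact congrArg (fun z => Glue.cyl _ _ z r) (orb_smul t x)
    · rw [← hl, Φ.symm_apply_apply]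
      exact congrArg (fun z => Glue.left _ _ z) (orb_smul (θ t) a)
    · rw [← hr, Φ.symm_apply_apply]
      exact congrArg (fun z => Glue.right _ _ z) (orb_smul (θ t) b)
  let ψ : OrbitSpace T Z → Glue (orbMap θ p hp) (orbMap θ q hq) :=
    Quotient.lift (fun z => G (Φ.symm z)) (by
      rintro _ z ⟨t, rfl⟩
      have := hinv t (Φ.symm z)
      rwa [Φ.apply_symm_apply] at this)
  have hψ : ∀ y, ψ (orb T (Φ y)) = G y := fun y => congrArg G (Φ.symm_apply_apply y)
  refine ⟨⟨⟨Glue.desc f g h h0 h1, ψ, fun y => ?_, ?_⟩, Glue.continuous_desc hf hg hh h0 h1,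
    (hG.comp Φ.symm.continuous).quotient_lift _⟩, fun x r => rfl, fun a => rfl, fun b => rfl⟩
  · refine Glue.ind ?_ ?_ ?_ y
    · rintro ⟨x⟩ r; exact hψ _
    · rintro ⟨a⟩; exact hψ _
    · rintro ⟨b⟩; exact hψ _
  · rintro ⟨z⟩
    obtain ⟨y, rfl⟩ := Φ.surjective z
    change Glue.desc f g h h0 h1 (ψ (orb T (Φ y))) = orb T (Φ y)
    rw [hψ]
    exact Glue.ind (fun x r => rfl) (fun a => rfl) (fun b => rfl) y

end Orbits

theorem Torus.drop_surjective {n : ℕ} (j : Fin (n + 1)) :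
    Function.Surjective (Torus.drop j) := fun t =>
  ⟨j.insertNth 1 t, by ext i; simp [Torus.drop]⟩

instance (n k : ℕ) : ContinuousConstSMul (Torus n) (Gr n k) where
  continuous_const_smul t := by
    rw [Gr.isEmbedding_proj.continuous_iff]
    have h : Continuous (conjBy t.unitary) := by unfold conjBy; fun_prop
    exact (h.comp Gr.continuous_proj).congr fun L => (Gr.proj_smul t L).symm

instance (n k : ℕ) (S : SubMulAction (Torus n) (Gr n k)) : ContinuousConstSMul (Torus n) S where
  continuous_const_smul t := by
    rw [continuous_induced_rng]
    exact (continuous_const_smul t).comp continuous_subtype_val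

/-! ## The orbit space of complex projective space -/

section Lines

variable {n : ℕ}

theorem Gr.exists_proj_eq_lineProj (L : Gr n 1) : ∃ z, ‖z‖ = 1 ∧ L.proj = lineProj z := by
  obtain ⟨z, hz, hz1⟩ := exists_unit_mem (K := L.1) (fun h => by
    have := L.2
    rw [h, finrank_bot] at this
    omega)
  refine ⟨z, hz1, Gr.proj_eq (isStarProjection_rankOne_self hz1) ?_⟩
  have hz0 : z ≠ 0 := by rintro rfl; simp at hz1
  have h1 : Submodule.span ℂ {z} = L.1 := by
    refine Submodule.eq_of_le_of_finrank_eq ((Submodule.span_singleton_le_iff_mem _ _).2 hz) ?_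
    rw [finrank_span_singleton hz0, L.2]
  rw [← h1]
  ext x
  rw [Submodule.mem_span_singleton]
  constructor
  · rintro ⟨y, rfl⟩
    exact ⟨_, rfl⟩
  · rintro ⟨c, rfl⟩
    exact ⟨c • z, by simp [hz1]⟩

theorem height_lineProj_single (z : CSpace n) (i : Fin n) :
    height (EuclideanSpace.single i 1) (lineProj z) = ‖z i‖ ^ 2 := by
  rw [height, rankOne_apply, inner_smul_right, ← inner_conj_symm, mul_comm, Complex.mul_conj,
    Complex.normSq_eq_norm_sq, Complex.ofReal_re, EuclideanSpace.inner_single_left]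
  simp

/-- The moment map of complex projective space. -/
noncomputable def momentMap (L : Gr n 1) : stdSimplex ℝ (Fin n) :=
  ⟨fun i => height (EuclideanSpace.single i 1) L.proj,
    fun i => height_nonneg L.isStarProjection_proj _, by
      obtain ⟨z, hz, h⟩ := L.exists_proj_eq_lineProj
      simp only [h, height_lineProj_single]
      rw [← EuclideanSpace.norm_sq_eq, hz, one_pow]⟩

theorem continuous_momentMap : Continuous (momentMap (n := n)) :=
  Continuous.subtype_mk (continuous_pi fun _ =>
    (contDiff_height _).continuous.comp Gr.continuous_proj) _

theorem momentMap_smul (t : Torus n) (L : Gr n 1) : momentMap (t • L) = momentMap L := by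
  apply Subtype.ext
  funext i
  change height _ (t • L).proj = height _ L.proj
  rw [Gr.proj_smul, height_conjBy (t.unitary_single i) (Circle.norm_coe _)]

/-- Unit vectors spanning the two lines have coordinates of equal absolute value, hence differ by a
phase in each coordinate. The phase is arbitrary where the coordinate vanishes. -/
theorem exists_smul_eq_of_momentMap_eq {L M : Gr n 1} (h : momentMap L = momentMap M) :
    ∃ t : Torus n, t • M = L := by
  obtain ⟨z, -, hz⟩ := L.exists_proj_eq_lineProj
  obtain ⟨w, -, hw⟩ := M.exists_proj_eq_lineProj
  have h1 : ∀ i, ‖z i‖ = ‖w i‖ := fun i => by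
    have := congrFun (congrArg Subtype.val h) i
    change height _ L.proj = height _ M.proj at this
    rw [hz, hw, height_lineProj_single, height_lineProj_single] at this
    exact (sq_eq_sq₀ (norm_nonneg _) (norm_nonneg _)).1 this
  have h2 : ∀ i, ∃ c : Circle, c * w i = z i := fun i => by
    by_cases hi : w i = 0
    · exact ⟨1, by rw [hi, mul_zero, eq_comm, ← norm_eq_zero, h1, hi, norm_zero]⟩
    · refine ⟨⟨z i / w i, ?_⟩, div_mul_cancel₀ _ hi⟩
      change _ ∈ Metric.sphere (0 : ℂ) 1
      rw [mem_sphere_zero_iff_norm, norm_div, h1, div_self (norm_ne_zero_iff.2 hi)]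
  choose t ht using h2
  refine ⟨t, Gr.proj_injective ?_⟩
  have h3 : Torus.unitary t w = z := by ext i; exact ht i
  rw [Gr.proj_smul, hw, hz, conjBy_lineProj, h3]

theorem momentMap_surjective : Function.Surjective (momentMap (n := n)) := by
  intro x
  let z : CSpace n := WithLp.toLp 2 fun i => (√(x.1 i) : ℂ)
  have hz : ∀ i, ‖z i‖ ^ 2 = x.1 i := fun i => by
    change ‖(√(x.1 i) : ℂ)‖ ^ 2 = _
    rw [Complex.norm_real, Real.norm_eq_abs, sq_abs, Real.sq_sqrt (x.2.1 i)]
  have hz1 : ‖z‖ = 1 := by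
    rw [← pow_eq_one_iff_of_nonneg (norm_nonneg _) two_ne_zero, EuclideanSpace.norm_sq_eq]
    simp only [hz]
    exact x.2.2
  refine ⟨Gr.ofProj (lineProj z) (isStarProjection_rankOne_self hz1) (by
    rw [trace_rankOne, inner_self_eq_ofReal, hz1]; simp), Subtype.ext (funext fun i => ?_)⟩
  change height _ (Gr.proj _) = _
  rw [Gr.proj_ofProj, height_lineProj_single, hz]

/-- The moment map descends to a continuous bijection from a compact space onto the simplex, hence
to a homeomorphism; for `n ≠ 0` the simplex is nonempty and convex. -/
theorem contractibleSpace_orbitSpace_lines (hn : n ≠ 0) :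
    ContractibleSpace (OrbitSpace (Torus n) (Gr n 1)) := by
  have : NeZero n := ⟨hn⟩
  have : ContractibleSpace (stdSimplex ℝ (Fin n)) :=
    (convex_stdSimplex ℝ (Fin n)).contractibleSpace ⟨_, single_mem_stdSimplex ℝ 0⟩
  let f : OrbitSpace (Torus n) (Gr n 1) → stdSimplex ℝ (Fin n) :=
    Quotient.lift momentMap (by rintro _ L ⟨t, rfl⟩; exact momentMap_smul t L)
  have hf : Continuous f := continuous_momentMap.quotient_lift _
  have hb : Function.Bijective f := by
    constructor
    · rintro ⟨L⟩ ⟨M⟩ h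
      exact Quotient.sound (exists_smul_eq_of_momentMap_eq h)
    · intro x
      obtain ⟨L, rfl⟩ := momentMap_surjective x
      exact ⟨orb _ L, rfl⟩
  exact (Continuous.homeoOfEquivCompactToT2 (f := Equiv.ofBijective f hb) hf).contractibleSpace

end Lines

theorem nonempty_orbitSpace_top_homeomorph (n : ℕ) :
    Nonempty (OrbitSpace (Torus n) (Gr n n) ≃ₜ PUnit.{1}) := by
  have h : ∀ L : Gr n n, L.1 = ⊤ := fun L =>
    Submodule.eq_top_of_finrank_eq (by rw [L.2, finrank_euclideanSpace_fin])
  let L₀ : Gr n n := ⟨⊤, by rw [finrank_top, finrank_euclideanSpace_fin]⟩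
  let _ : Unique (OrbitSpace (Torus n) (Gr n n)) :=
    { default := orb _ L₀
      uniq := by
        rintro ⟨L⟩
        exact congrArg (orb _) (Subtype.ext (h L)) }
  exact ⟨Homeomorph.homeomorphOfUnique _ _⟩

end TorusGrassmannian

theorem mainTheorem9 :
    (∀ (n k : ℕ), k < n → ∀ j : Fin (n + 1),
      ∃ S : SubMulAction (Torus (n + 1)) (Gr (n + 1) (k + 1)),
        -- `S` is a closed smooth invariant submanifold of codimension one
        IsClosed (S : Set (Gr (n + 1) (k + 1))) ∧
        IsSmoothHypersurface
          (S : Set (Gr (n + 1) (k + 1))) ∧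
        -- the equivariant projections
        ∃ (π₀ : S → Gr n (k + 1)) (π₁ : S → Gr n k),
          IsSmoothMap (fun s : S => s.1.proj) Gr.proj π₀ ∧
          IsSmoothMap (fun s : S => s.1.proj) Gr.proj π₁ ∧
          Function.Surjective π₀ ∧ Function.Surjective π₁ ∧
          (∀ (t : Torus (n + 1)) (s : S), π₀ (t • s) = t.drop j • π₀ s) ∧
          (∀ (t : Torus (n + 1)) (s : S), π₁ (t • s) = t.drop j • π₁ s) ∧
          -- the decomposition of the Grassmann manifold
          ∃ Φ : Glue π₀ π₁ ≃ₜ Gr (n + 1) (k + 1),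
            (∀ (t : Torus (n + 1)) (s : S) (x : unitInterval),
              Φ (Glue.cyl π₀ π₁ (t • s) x) =
                t • Φ (Glue.cyl π₀ π₁ s x)) ∧
            (∀ a, Φ (Glue.left π₀ π₁ a) = inclZero j a) ∧
            (∀ b, Φ (Glue.right π₀ π₁ b) = inclOne j b) ∧
            (∀ s : S, Φ (Glue.cyl π₀ π₁ s middle) = s.1) ∧
            -- off the two ends it is a diffeomorphism
            (∃ Ψ : S × Set.Ioo (0 : ℝ) 1 ≃
                ((Set.range (inclZero (k := k + 1) j) ∪
                  Set.range (inclOne (k := k) j))ᶜ :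
                  Set (Gr (n + 1) (k + 1))),
              IsSmoothMap
                (fun y : S × Set.Ioo (0 : ℝ) 1 => (y.1.1.proj, (y.2 : ℝ)))
                (fun L => L.1.proj) Ψ ∧
              IsSmoothMap (fun L => L.1.proj)
                (fun y : S × Set.Ioo (0 : ℝ) 1 => (y.1.1.proj, (y.2 : ℝ))) Ψ.symm ∧
              ∀ (s : S) (x : Set.Ioo (0 : ℝ) 1), (Ψ (s, x)).1 =
                Φ (Glue.cyl π₀ π₁ s (openToUnit x))) ∧
            -- the induced projections and the decomposition of the orbit space
            ∃ (p₀ : OrbitSpace (Torus (n + 1)) S →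
                OrbitSpace (Torus n)
                  (Gr n (k + 1)))
              (p₁ : OrbitSpace (Torus (n + 1)) S →
                OrbitSpace (Torus n)
                  (Gr n k)),
              Continuous p₀ ∧ Continuous p₁ ∧
              (∀ s : S, p₀ (orb (Torus (n + 1)) s) =
                orb (Torus n) (π₀ s)) ∧
              (∀ s : S, p₁ (orb (Torus (n + 1)) s) =
                orb (Torus n) (π₁ s)) ∧
              (∃ φ : Glue p₀ p₁ ≃ₜ
                  OrbitSpace (Torus (n + 1))
                    (Gr (n + 1) (k + 1)),
                (∀ (s : S) (x : unitInterval),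
                  φ (Glue.cyl p₀ p₁
                      (orb (Torus (n + 1)) s) x) =
                    orb (Torus (n + 1))
                      (Φ (Glue.cyl π₀ π₁ s x))) ∧
                (∀ a, φ (Glue.left p₀ p₁
                      (orb (Torus n) a)) =
                    orb (Torus (n + 1))
                      (inclZero j a)) ∧
                (∀ b, φ (Glue.right p₀ p₁
                      (orb (Torus n) b)) =
                    orb (Torus (n + 1))
                      (inclOne j b))) ∧
              -- for two-dimensional subspaces: attaching a cone
              (k = 1 → Nonempty (ContinuousMap.HomotopyEquiv
                (OrbitSpace (Torus (n + 1))
                  (Gr (n + 1) (k + 1)))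
                (AttachCone p₀)))) ∧
    -- the start of the induction for two-dimensional subspaces
    Nonempty (OrbitSpace (Torus 2)
      (Gr 2 2) ≃ₜ PUnit.{1}) := by
  refine ⟨fun n k hk j => ⟨middleLevel n k j, isClosed_middleLevel,
    isSmoothHypersurface_middleLevel, projZero, projOne, isSmoothMap_projZero, isSmoothMap_projOne,
    projZero_surjective, projOne_surjective hk, projZero_smul, projOne_smul, glueHomeo,
    cylPoint_smul, fun _ => rfl, fun _ => rfl, cylPoint_middle,
    ⟨genericEquiv, isSmoothMap_genericEquiv, isSmoothMap_genericEquiv_symm, fun _ _ => rfl⟩,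
    orbMap (Torus.drop j) projZero projZero_smul, orbMap (Torus.drop j) projOne projOne_smul,
    continuous_orbMap _ continuous_projZero, continuous_orbMap _ continuous_projOne,
    fun _ => rfl, fun _ => rfl, ?_, ?_⟩, nonempty_orbitSpace_top_homeomorph 2⟩
  · exact exists_orbit_homeomorph (Torus.drop_surjective j) projZero_smul projOne_smul glueHomeo
      cylPoint_smul inclZero_smul inclOne_smul
  -- With `k = 1` the end at 1 is the orbit space of `Gr n 1`, which is contractible.
  · rintro rfl
    obtain ⟨φ, -⟩ := exists_orbit_homeomorph (Torus.drop_surjective j) projZero_smul projOne_smul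
      (glueHomeo (n := n) (k := 1) (j := j)) cylPoint_smul inclZero_smul inclOne_smul
    have := contractibleSpace_orbitSpace_lines (n := n) (by omega)
    obtain ⟨h⟩ := Glue.homotopyEquiv_attachCone
      (p := orbMap (Torus.drop j) (projZero (n := n) (k := 1) (j := j)) projZero_smul)
      (continuous_orbMap (projOne_smul (n := n) (k := 1) (j := j)) continuous_projOne)
    exact ⟨φ.symm.toHomotopyEquiv.trans h⟩
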